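/- **Conventions.** A Fréchet space $(F,d)$ carries a fixed *standard* metric: $d$ is complete, translation invariant, induces the topology, and has absolutely convex balls; put $\|x\|_d=d(x,0)$. The line $\mathbb R$ carries its usual metric. For Fréchet spaces $(E,g)$, $(F,d)$ let $\mathcal L_{g,d}(E,F)$ be the group of linear maps $L:E\to F$ with $\|L\|_{g,d}=\sup_{x\ne 0}\|Lx\|_d/\|x\|_g<\infty$, with the metric $\|L-H\|_{g,d}$. Let $U\subseteq E$ be open. A map $P:U\to F$ is $MC^0$ if it is continuous. It is $MC^1$ if it is continuous, for all $x\in U$, $h\in E$ the limit $P'(x)h=\lim_{t\to0}(P(x+th)-P(x))/t$ exists, $P'(x)\in\mathcal L_{g,d}(E,F)$, and $P':U\to\mathcal L_{g,d}(E,F)$ is continuous. It is $MC^{k+1}$ ($k\ge1$) if it is $MC^1$ and each $x_0\in U$ has a connected open neighbourhood $V\subseteq U$ such that $P'-P'(x_0)$ is $MC^{k}$ on $V$, as a map into the identity component of $\mathcal L_{g,d}(E,F)$ (a Fréchet space with standard metric $\|L-H\|_{g,d}$). It is $MC^\infty$ if it is $MC^k$ for all $k$. For a curve $c$ in $F$,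 $c'(t)=\lim_{s\to0}(c(t+s)-c(t))/s$. A *bounded Fréchet manifold* $M$ modelled on $F$ is a Hausdorff, second countable space with an atlas of charts $\varphi:U_\varphi\to\varphi(U_\varphi)$ (homeomorphisms from open subsets of $M$ onto open subsets of $F$) whose transition maps are $MC^\infty$. A curve in $M$ is $MC^k$ if it is continuous and $MC^k$ in the charts. The tangent space $T_pM$ is the set of classes $j^1_p f$ of $MC^\infty$-curves $f:\mathbb R\to M$ with $f(0)=p$, where $f\sim g$ if $(\varphi\circ f)'(0)=(\varphi\circ g)'(0)$ in the charts $\varphi$ at $p$; $TM=\bigsqcup_p T_pM$, with projection $\pi_M$. A *vector field* of class $MC^k$ is a map $\xi:M\to TM$ with $\pi_M\circ\xi=\mathrm{id}_M$ whose principal parts $\xi_\varphi:\varphi(U_\varphi)\to F$, $\xi_\varphi(\varphi(q))=(\varphi\circ f)'(0)$ for $\xi(q)=j^1_q f$, are $MC^k$ for all charts $\varphi$ of the atlas. An *integral curve* of $\xi$ is a continuous map $\ell:I\to M$ on an open interval $I$ such that, for every $t\in I$ and every chart $\varphi$ of the atlas at $\ell(t)$, the derivative $(\varphi\circ\ell)'(t)$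 exists and equals $\xi_\varphi(\varphi(\ell(t)))$. **Theorem.** Let $M$ be a bounded Fréchet manifold modelled on a Fréchet space $F$, let $\xi:M\to TM$ be a vector field of class $MC^k$, $1\le k\le\infty$, and let $p\in M$ and $t_0\in\mathbb R$. Then there are an open interval $I\ni t_0$ and an integral curve $\ell:I\to M$ of $\xi$ with $\ell(t_0)=p$, and $\ell$ can be taken of class $MC^1$. Moreover, any two integral curves $\ell_1:I_1\to M$ and $\ell_2:I_2\to M$ of $\xi$ with $t_0\in I_1\cap I_2$ and $\ell_1(t_0)=\ell_2(t_0)=p$ are equal on $I_1\cap I_2$. -/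

import Mathlib

open Set Filter Topology
open scoped ENNReal

universe u v w

/-- A real Fréchet space whose topology is given by a fixed *standard* metric: a complete
translation-invariant metric, compatible with the vector space structure, all of whose balls are
absolutely convex. (Continuity of addition follows from the invariance of the metric.) -/
class StandardFrechetSpace (F : Type u) [AddCommGroup F] [Module ℝ F] [MetricSpace F] : Prop where
  complete : CompleteSpace F
  dist_add_right : ∀ x y z : F, dist (x + z) (y + z) = dist x y
  continuous_smul : Continuous fun p : ℝ × F => p.1 • p.2
  absConvex_ball : ∀ r : ℝ, AbsConvex ℝ (Metric.ball (0 : F) r)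

namespace BoundedFrechet

/-- `‖x‖_d = d(x, 0)`, with values in `[0, ∞]`. -/
noncomputable def metricNorm (F : Type u) [AddCommGroup F] [MetricSpace F] (x : F) : ℝ≥0∞ :=
  edist x 0

section MC

variable {E : Type u} [AddCommGroup E] [Module ℝ E] [MetricSpace E]

/-- The Lipschitz norm `‖L‖_{g,q} = sup_{x ≠ 0} q(L x) / ‖x‖_g` of a linear map `L : E → G`.
It is finite exactly when `L` is globally Lipschitz; on the group of those maps
`(L, H) ↦ ‖L - H‖_{g,q}` is the metric that defines the topology. -/
noncomputable def lipNorm {G : Type w} [AddCommGroup G] [Module ℝ G] (q : G → ℝ≥0∞)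
    (L : E →ₗ[ℝ] G) : ℝ≥0∞ :=
  ⨆ (x : E) (_ : x ≠ 0), q (L x) / metricNorm E x

/-- Continuity on `U` with respect to the metric `(a, b) ↦ q (a - b)` on the target. -/
def QContinuousOn {G : Type w} [AddCommGroup G] (q : G → ℝ≥0∞) (U : Set E) (P : E → G) : Prop :=
  ∀ x ∈ U, Tendsto (fun y => q (P y - P x)) (𝓝[U] x) (𝓝 0)

/-- `lim_{t → 0} (P (x + t h) - P x) / t = v` with respect to the metric `(a, b) ↦ q (a - b)`. -/
def HasDirDeriv {G : Type w} [AddCommGroup G] [Module ℝ G] (q : G → ℝ≥0∞) (P : E → G)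
    (x h : E) (v : G) : Prop :=
  Tendsto (fun t : ℝ => q (t⁻¹ • (P (x + t • h) - P x) - v)) (𝓝[≠] 0) (𝓝 0)

/-- `MC^k`-maps `P : U → G`, where `U ⊆ E` is open and `G` carries the metric `q (a - b)`.

* `MC^0` means continuous.
* `P` is `MC^(k+1)` if it is continuous, all directional derivatives exist and form a globally
  Lipschitz linear map `P' x` for each `x ∈ U`, and every `x₀ ∈ U` has a connected open
  neighbourhood `V ⊆ U` on which `P' - P' x₀` is `MC^k` for the metric given by `lipNorm q`.

For `k = 0` the last clause says that `P'` is continuous into the group of Lipschitz linear maps.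
Since `V` is connected and `P'` is continuous, `P' - P' x₀` takes its values in the connected
component of `0` of that group. This component is a closed vector subspace, so difference quotients
of `P'` and their limits stay in it and one need not mention it. -/
def IsMCNat : ℕ → ∀ (G : Type (max u v)) [AddCommGroup G] [Module ℝ G],
    (G → ℝ≥0∞) → Set E → (E → G) → Prop
  | 0, _, _, _, q, U, P => QContinuousOn q U P
  | k + 1, G, _, _, q, U, P =>
      QContinuousOn q U P ∧
        ∃ P' : E → E →ₗ[ℝ] G,
          (∀ x ∈ U, lipNorm q (P' x) < ∞ ∧ ∀ h, HasDirDeriv q P x h (P' x h)) ∧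
          ∀ x₀ ∈ U, ∃ V : Set E, IsOpen V ∧ IsConnected V ∧ x₀ ∈ V ∧ V ⊆ U ∧
            IsMCNat k (E →ₗ[ℝ] G) (lipNorm q) V (fun x => P' x - P' x₀)

/-- `MC^k`-maps `U → F` between metric vector spaces, `k ∈ {0, 1, 2, …, ∞}`. -/
def IsMCOn {F : Type (max u v)} [AddCommGroup F] [Module ℝ F] [MetricSpace F]
    (k : ℕ∞) (U : Set E) (P : E → F) : Prop :=
  ∀ n : ℕ, (n : ℕ∞) ≤ k → IsMCNat.{u, v} n F (metricNorm F) U P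

end MC

section CurvesInF

variable {F : Type u} [AddCommGroup F] [Module ℝ F] [MetricSpace F]

/-- `c'(t) = v` for a curve `c` in `F`. -/
def HasVelocity (c : ℝ → F) (t : ℝ) (v : F) : Prop :=
  HasDirDeriv (metricNorm F) c t 1 v

open Classical in
/-- The derivative `c'(t)` of a curve in `F` (zero if it does not exist). -/
noncomputable def velocity (c : ℝ → F) (t : ℝ) : F :=
  if h : ∃ v, HasVelocity c t v then h.choose else 0

end CurvesInF

end BoundedFrechet

open BoundedFrechet

/-- A bounded Fréchet manifold modelled on `F`: a Hausdorff second countable space with an atlas of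
charts in `F` whose transition functions are `MC^∞`. -/
class BoundedFrechetManifold (F : Type u) [AddCommGroup F] [Module ℝ F] [MetricSpace F]
    (M : Type v) [TopologicalSpace M] [ChartedSpace F M] : Prop where
  t2 : T2Space M
  secondCountable : SecondCountableTopology M
  transition_MC : ∀ φ ∈ atlas F M, ∀ ψ ∈ atlas F M,
    IsMCOn.{u, u} ⊤ (φ.symm.trans ψ).source (φ.symm.trans ψ : F → F)

namespace BoundedFrechet

variable (F : Type u) [AddCommGroup F] [Module ℝ F] [MetricSpace F]
variable {M : Type v} [TopologicalSpace M] [ChartedSpace F M]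

/-- `MC^k`-curves in `M`, defined on an open set `I` of real numbers (values of `ℓ` outside `I` do
not matter): continuous and `MC^k` in the charts. -/
def IsMCCurveOn (k : ℕ∞) (I : Set ℝ) (ℓ : ℝ → M) : Prop :=
  ContinuousOn ℓ I ∧
    ∀ φ ∈ atlas F M, IsMCOn.{0, u} k (I ∩ ℓ ⁻¹' φ.source) (fun t => φ (ℓ t))

/-- The `MC^∞`-maps `ℝ → M` that send `0` to `p`. -/
def MCCurvesAt (p : M) : Type v :=
  {f : ℝ → M // IsMCCurveOn F ⊤ univ f ∧ f 0 = p}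

/-- Two such curves are equivalent if they have the same derivative at `0` in the charts at `p`. -/
def jetSetoid (p : M) : Setoid (MCCurvesAt F p) where
  r f g := ∀ φ ∈ atlas F M, p ∈ φ.source →
    velocity (fun t => φ (f.1 t)) 0 = velocity (fun t => φ (g.1 t)) 0
  iseqv :=
    { refl := fun _ _ _ _ => rfl
      symm := fun h φ hφ hp => (h φ hφ hp).symm
      trans := fun h₁ h₂ φ hφ hp => (h₁ φ hφ hp).trans (h₂ φ hφ hp) }

/-- `T_p M`: the set of 1-jets at `p` of `MC^∞`-curves through `p`. -/
def TangentAt (p : M) : Type v := Quotient (jetSetoid F p)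

variable (M) in
/-- `TM`: the set of all 1-jets of `M`. -/
def TangentBdl : Type v := Σ p : M, TangentAt F p

variable {F}

/-- The projection `π_M : TM → M`. -/
def TangentBdl.proj (V : TangentBdl F M) : M := V.1

open Classical in
/-- `j¹_p(f) ↦ (φ ∘ f)'(0)` for a chart `φ` of the atlas at `p` (zero for other `φ`). -/
noncomputable def chartVelocity (φ : OpenPartialHomeomorph M F) (p : M) (V : TangentAt F p) : F :=
  if h : φ ∈ atlas F M ∧ p ∈ φ.source then
    Quotient.lift (s := jetSetoid F p) (fun f => velocity (fun t => φ (f.1 t)) 0)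
      (fun _ _ hfg => hfg φ h.1 h.2) V
  else 0

/-- The chart `Tφ : π_M⁻¹(U) → φ(U) × F`, `j¹_p(f) ↦ (φ(p), (φ ∘ f)'(0))`, of `TM`. -/
noncomputable def tangentChart (φ : OpenPartialHomeomorph M F) (V : TangentBdl F M) : F × F :=
  (φ V.1, chartVelocity φ V.1 V.2)

/-- The principal part `ξ_φ : φ(U) → F` of `ξ : M → TM` in the chart `φ`. -/
noncomputable def principalPart (ξ : M → TangentBdl F M) (φ : OpenPartialHomeomorph M F)
    (y : F) : F :=
  (tangentChart φ (ξ (φ.symm y))).2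

/-- A vector field of class `MC^k`: a section of `π_M : TM → M` whose principal parts are `MC^k`. -/
structure IsVectorField (k : ℕ∞) (ξ : M → TangentBdl F M) : Prop where
  section_proj : ∀ p, (ξ p).proj = p
  principalPart_MC : ∀ φ ∈ atlas F M, IsMCOn.{u, u} k φ.target (principalPart ξ φ)

/-- `ℓ : I → M` is an integral curve of `ξ`: `I` is an open interval, `ℓ` is continuous on `I`, and
`(φ ∘ ℓ)'(t) = ξ_φ(φ(ℓ(t)))` for every `t ∈ I` and every chart `φ` of the atlas at `ℓ(t)`. -/
structure IsIntegralCurveOfField (ξ : M → TangentBdl F M) (I : Set ℝ) (ℓ : ℝ → M) : Prop where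
  isOpen : IsOpen I
  ordConnected : I.OrdConnected
  continuousOn : ContinuousOn ℓ I
  hasVelocity : ∀ t ∈ I, ∀ φ ∈ atlas F M, ℓ t ∈ φ.source →
    HasVelocity (fun s => φ (ℓ s)) t (principalPart ξ φ (φ (ℓ t)))

end BoundedFrechet

namespace BoundedFrechet

/-! The equation is solved in a Banach space hidden inside `F`. A tangent vector is the velocity of
a curve that is `MC^1` on `ℝ`, and the derivative of such a curve is a Lipschitz linear map `s ↦ s •
v` from `ℝ` to `F`. So every principal part takes values in the space `LipVec F` of vectors of
finite `radialNorm`, which is complete under that norm. A linear map with `lipNorm` at most `K` also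
stretches `radialNorm` by at most `K`; by the mean value theorem an `MC^1` field is therefore
locally Lipschitz for `radialNorm`, and Picard–Lindelöf on the slice `x + LipVec F` gives existence
(`HasMCDerivOn.exists_velocity`).

Uniqueness is subtler, because an integral curve is differentiable only in the topology of `F`: a
priori the radial norm of its velocity is merely finite at each time and lower semicontinuous. On a
short interval where this function is bounded, the Lipschitz estimate shows that its values agree up
to a factor `2`; a Baire category argument (`exists_bound_of_harnack`) then removes the boundedness
assumption. Hence integral curves are locally Lipschitz for `radialNorm`, and the usual contraction
estimate proves local uniqueness (`HasMCDerivOn.eventuallyEq_of_velocity`). The same bound makes the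
velocity continuous for `radialNorm`, which is the `MC^1` property of the curve. Connectedness of
`I₁ ∩ I₂` and the Hausdorff property turn local uniqueness into global uniqueness. -/

theorem metricNorm_zero {F : Type u} [AddCommGroup F] [MetricSpace F] :
    metricNorm F (0 : F) = 0 :=
  edist_self _

theorem continuous_metricNorm {F : Type u} [AddCommGroup F] [MetricSpace F] :
    Continuous (metricNorm F) :=
  continuous_id.edist continuous_const

/-! ### Topology of a standard Fréchet space, velocities of curves, and the mean value theorem. -/

section Topology

variable {F : Type u} [AddCommGroup F] [Module ℝ F] [MetricSpace F] [StandardFrechetSpace F]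

instance instCompleteSpaceOfStandard : CompleteSpace F := StandardFrechetSpace.complete

instance instContinuousSMulOfStandard : ContinuousSMul ℝ F :=
  ⟨StandardFrechetSpace.continuous_smul⟩

theorem dist_sub_zero_eq (x y : F) : dist (x - y) 0 = dist x y := by
  have h := StandardFrechetSpace.dist_add_right (x - y) 0 y
  rw [sub_add_cancel, zero_add] at h
  exact h.symm

theorem metricNorm_sub (x y : F) : metricNorm F (x - y) = edist x y := by
  rw [metricNorm, edist_dist, edist_dist, dist_sub_zero_eq]

instance instIsTopologicalAddGroupOfStandard : IsTopologicalAddGroup F where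
  continuous_add := by
    have h : LipschitzWith 2 fun p : F × F => p.1 + p.2 := by
      refine LipschitzWith.of_dist_le_mul fun p q => ?_
      have h1 := StandardFrechetSpace.dist_add_right p.1 q.1 p.2
      have h2 := StandardFrechetSpace.dist_add_right p.2 q.2 q.1
      rw [add_comm p.2, add_comm q.2] at h2
      have h3 := dist_triangle (p.1 + p.2) (q.1 + p.2) (q.1 + q.2)
      have h4 : dist p.1 q.1 ≤ dist p q := le_max_left _ _
      have h5 : dist p.2 q.2 ≤ dist p q := le_max_right _ _
      push_cast
      linarith
    exact h.continuous
  continuous_neg := by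
    refine (continuous_const_smul (-1 : ℝ)).congr fun x => ?_
    rw [neg_one_smul]

theorem convex_ball_of_standard (x : F) (r : ℝ) : Convex ℝ (Metric.ball x r) := by
  have h : Metric.ball x r = (fun y => -x + y) ⁻¹' Metric.ball (0 : F) r := by
    ext y
    rw [mem_preimage, Metric.mem_ball, Metric.mem_ball, neg_add_eq_sub, dist_sub_zero_eq]
  rw [h]
  exact (StandardFrechetSpace.absConvex_ball r).2.translate_preimage_right (-x)

theorem convex_closedBall_of_standard (x : F) (r : ℝ) : Convex ℝ (Metric.closedBall x r) := by
  have h : Metric.closedBall x r = ⋂ (s : ℝ) (_ : r < s), Metric.ball x s := by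
    ext y
    simp only [Metric.mem_closedBall, mem_iInter, Metric.mem_ball]
    exact ⟨fun h s hs => h.trans_lt hs, fun h => le_of_forall_gt h⟩
  rw [h]
  exact convex_iInter₂ fun s _ => convex_ball_of_standard x s

instance instLocallyConvexSpaceOfStandard : LocallyConvexSpace ℝ F :=
  LocallyConvexSpace.ofBases ℝ F (fun x r => Metric.ball x r) (fun _ r => 0 < r)
    (fun _ => Metric.nhds_basis_ball) fun x r _ => convex_ball_of_standard x r

theorem metricNorm_add_le (x y : F) : metricNorm F (x + y) ≤ metricNorm F x + metricNorm F y := by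
  have h : metricNorm F (x + y) = edist x (-y) := by rw [← metricNorm_sub, sub_neg_eq_add]
  have h' : metricNorm F y = edist 0 (-y) := by rw [← metricNorm_sub, zero_sub, neg_neg]
  rw [h, h']
  exact edist_triangle _ _ _

theorem hasDirDeriv_iff_tendsto {E : Type v} [AddCommGroup E] [Module ℝ E] {P : E → F} {x h : E}
    {v : F} : HasDirDeriv (metricNorm F) P x h v ↔
      Tendsto (fun t : ℝ => t⁻¹ • (P (x + t • h) - P x)) (𝓝[≠] 0) (𝓝 v) := by
  rw [tendsto_iff_edist_tendsto_0]
  simp only [HasDirDeriv, metricNorm_sub]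

theorem hasVelocity_iff_tendsto {c : ℝ → F} {t : ℝ} {v : F} : HasVelocity c t v ↔
      Tendsto (fun s : ℝ => s⁻¹ • (c (t + s) - c t)) (𝓝[≠] 0) (𝓝 v) := by
  simp [HasVelocity, hasDirDeriv_iff_tendsto]

theorem HasVelocity.unique {c : ℝ → F} {t : ℝ} {v w : F} (hv : HasVelocity c t v)
    (hw : HasVelocity c t w) : v = w :=
  tendsto_nhds_unique (hasVelocity_iff_tendsto.1 hv) (hasVelocity_iff_tendsto.1 hw)

theorem HasVelocity.velocity_eq {c : ℝ → F} {t : ℝ} {v : F} (hv : HasVelocity c t v) :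
    velocity c t = v := by
  have h : ∃ v, HasVelocity c t v := ⟨v, hv⟩
  rw [velocity, dif_pos h]
  exact h.choose_spec.unique hv

theorem HasDirDeriv.hasVelocity {E : Type v} [AddCommGroup E] [Module ℝ E] {P : E → F} {x h : E}
    {v : F} {θ : ℝ} (H : HasDirDeriv (metricNorm F) P (x + θ • h) h v) :
    HasVelocity (fun s => P (x + s • h)) θ v := by
  rw [hasDirDeriv_iff_tendsto] at H
  rw [hasVelocity_iff_tendsto]
  simpa only [add_smul, add_assoc] using H

theorem HasVelocity.congr_of_eventuallyEq {c c' : ℝ → F} {t : ℝ} {v : F} (hv : HasVelocity c t v)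
    (h : c' =ᶠ[𝓝 t] c) : HasVelocity c' t v := by
  rw [hasVelocity_iff_tendsto] at hv ⊢
  have h1 : Tendsto (fun s : ℝ => t + s) (𝓝[≠] 0) (𝓝 t) := by
    have : Tendsto (fun s : ℝ => t + s) (𝓝 0) (𝓝 (t + 0)) :=
      (continuous_const.add continuous_id).tendsto 0
    rw [add_zero] at this
    exact this.mono_left nhdsWithin_le_nhds
  refine hv.congr' ?_
  filter_upwards [h1.eventually h] with s hs
  rw [hs, h.eq_of_nhds]

theorem HasVelocity.continuousAt {c : ℝ → F} {t : ℝ} {v : F} (hv : HasVelocity c t v) :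
    ContinuousAt c t := by
  rw [hasVelocity_iff_tendsto] at hv
  have h1 : Tendsto (fun s : ℝ => s • (s⁻¹ • (c (t + s) - c t))) (𝓝[≠] 0) (𝓝 ((0 : ℝ) • v)) :=
    (tendsto_id.mono_left nhdsWithin_le_nhds).smul hv
  have h2 : Tendsto (fun s : ℝ => c (t + s)) (𝓝[≠] 0) (𝓝 (c t)) := by
    have h3 := h1.add_const (c t)
    rw [zero_smul, zero_add] at h3
    refine h3.congr' ?_
    filter_upwards [self_mem_nhdsWithin] with s hs
    rw [smul_inv_smul₀ hs, sub_add_cancel]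
  have h4 : Tendsto (fun s : ℝ => c (t + s)) (𝓝 0) (𝓝 (c t)) := by
    rw [← nhdsNE_sup_pure, tendsto_sup]
    exact ⟨h2, by simpa using tendsto_pure_nhds (fun s : ℝ => c (t + s)) 0⟩
  have h5 : Tendsto (fun s => s - t) (𝓝 t) (𝓝 0) := by
    have := (continuous_sub_right t).tendsto t
    rwa [sub_self] at this
  refine (h4.comp h5).congr fun s => ?_
  simp

theorem HasVelocity.sub {c c' : ℝ → F} {t : ℝ} {v w : F} (hv : HasVelocity c t v)
    (hw : HasVelocity c' t w) : HasVelocity (fun s => c s - c' s) t (v - w) := by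
  rw [hasVelocity_iff_tendsto] at *
  refine (hv.sub hw).congr fun s => ?_
  rw [← smul_sub]
  congr 1
  abel

theorem hasVelocity_smul_const (w : F) (t : ℝ) : HasVelocity (fun s => s • w) t w := by
  rw [hasVelocity_iff_tendsto]
  refine (tendsto_const_nhds (x := w)).congr' ?_
  filter_upwards [self_mem_nhdsWithin] with s hs
  rw [← sub_smul, add_sub_cancel_left, smul_smul, inv_mul_cancel₀ hs, one_smul]

theorem HasVelocity.const_smul {c : ℝ → F} {t : ℝ} {v : F} (hv : HasVelocity c t v) (a : ℝ) :
    HasVelocity (fun s => a • c s) t (a • v) := by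
  rw [hasVelocity_iff_tendsto] at *
  refine (hv.const_smul a).congr fun s => ?_
  rw [smul_comm, smul_sub]

theorem HasVelocity.hasDerivAt_dual {c : ℝ → F} {t : ℝ} {v : F} (hv : HasVelocity c t v)
    (f : StrongDual ℝ F) : HasDerivAt (fun s => f (c s)) (f v) t := by
  rw [hasVelocity_iff_tendsto] at hv
  rw [hasDerivAt_iff_tendsto_slope_zero]
  refine ((f.continuous.tendsto v).comp hv).congr fun s => ?_
  simp

/-- Mean value theorem: a closed convex set that contains all velocities contains the slope. -/
theorem slope_mem_of_velocity_mem {c c' : ℝ → F} {a b : ℝ} (hab : a < b)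
    (hc : ContinuousOn c (Icc a b)) (hc' : ∀ t ∈ Ioo a b, HasVelocity c t (c' t)) {D : Set F}
    (hD : Convex ℝ D) (hD' : IsClosed D) (hmem : ∀ t ∈ Ioo a b, c' t ∈ D) :
    (b - a)⁻¹ • (c b - c a) ∈ D := by
  by_contra hn
  -- A slope outside `D` would be strictly separated from `D` by a functional `f`; the scalar mean
  -- value theorem for `f ∘ c` contradicts this.
  obtain ⟨f, r, hf, hr⟩ := geometric_hahn_banach_closed_point hD hD' hn
  obtain ⟨t, ht, h⟩ := exists_hasDerivAt_eq_slope (fun s => f (c s)) (fun s => f (c' s)) hab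
    (f.continuous.comp_continuousOn hc) fun s hs => (hc' s hs).hasDerivAt_dual f
  have h1 := hf _ (hmem t ht)
  have h2 : f ((b - a)⁻¹ • (c b - c a)) = f (c' t) := by
    rw [h, map_smul, map_sub, smul_eq_mul, div_eq_inv_mul]
  linarith

end Topology

/-! ### The Lipschitz norm of a linear map. -/

section LipNorm

variable {E : Type u} [AddCommGroup E] [Module ℝ E] [MetricSpace E]

theorem lipNorm_le_iff {G : Type w} [AddCommGroup G] [Module ℝ G] {q : G → ℝ≥0∞} (hq : q 0 = 0)
    {L : E →ₗ[ℝ] G} {C : ℝ≥0∞} : lipNorm q L ≤ C ↔ ∀ x, q (L x) ≤ C * metricNorm E x := by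
  rw [lipNorm, iSup₂_le_iff]
  refine forall_congr' fun x => ?_
  by_cases hx : x = 0
  · simp [hx, hq]
  · have h0 : metricNorm E x ≠ 0 := by simpa [metricNorm] using hx
    have ht : metricNorm E x ≠ ∞ := edist_ne_top _ _
    rw [ENNReal.div_le_iff h0 ht]
    exact ⟨fun h => h hx, fun h _ => h⟩

theorem le_lipNorm_mul {G : Type w} [AddCommGroup G] [Module ℝ G] {q : G → ℝ≥0∞} (hq : q 0 = 0)
    (L : E →ₗ[ℝ] G) (x : E) : q (L x) ≤ lipNorm q L * metricNorm E x :=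
  (lipNorm_le_iff hq).1 le_rfl x

theorem lipNorm_add_le {G : Type w} [AddCommGroup G] [Module ℝ G] {q : G → ℝ≥0∞} (hq : q 0 = 0)
    (hadd : ∀ x y, q (x + y) ≤ q x + q y) (L H : E →ₗ[ℝ] G) :
    lipNorm q (L + H) ≤ lipNorm q L + lipNorm q H := by
  rw [lipNorm_le_iff hq]
  intro x
  rw [add_mul]
  exact (hadd _ _).trans (add_le_add (le_lipNorm_mul hq L x) (le_lipNorm_mul hq H x))

end LipNorm

/-! ### The radial norm: homogeneous, unlike the metric, but possibly infinite. -/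

section RadialNorm

variable {F : Type u} [AddCommGroup F] [Module ℝ F] [MetricSpace F]

/-- `sup_{s ≠ 0} ‖s v‖_d / |s|`, the Lipschitz norm of `s ↦ s v`. -/
noncomputable def radialNorm (v : F) : ℝ≥0∞ :=
  lipNorm (metricNorm F) (LinearMap.toSpanSingleton ℝ F v)

theorem metricNorm_real (s : ℝ) : metricNorm ℝ s = ‖s‖ₑ := edist_zero_right s

theorem radialNorm_le_iff {v : F} {C : ℝ≥0∞} :
    radialNorm v ≤ C ↔ ∀ s : ℝ, metricNorm F (s • v) ≤ C * ‖s‖ₑ := by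
  rw [radialNorm, lipNorm_le_iff metricNorm_zero]
  simp only [LinearMap.toSpanSingleton_apply, metricNorm_real]

theorem metricNorm_smul_le (s : ℝ) (v : F) : metricNorm F (s • v) ≤ radialNorm v * ‖s‖ₑ :=
  radialNorm_le_iff.1 le_rfl s

theorem metricNorm_le_radialNorm (v : F) : metricNorm F v ≤ radialNorm v := by
  simpa using metricNorm_smul_le 1 v

theorem radialNorm_zero : radialNorm (0 : F) = 0 :=
  le_antisymm (radialNorm_le_iff.2 fun s => by simp [metricNorm_zero]) bot_le

theorem eq_zero_of_radialNorm_eq_zero {v : F} (h : radialNorm v = 0) : v = 0 := by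
  have h1 := metricNorm_le_radialNorm v
  rw [h, nonpos_iff_eq_zero] at h1
  exact edist_eq_zero.1 h1

variable [StandardFrechetSpace F]

theorem radialNorm_add_le (v w : F) : radialNorm (v + w) ≤ radialNorm v + radialNorm w := by
  rw [radialNorm_le_iff]
  intro s
  rw [smul_add, add_mul]
  exact (metricNorm_add_le _ _).trans (add_le_add (metricNorm_smul_le s v) (metricNorm_smul_le s w))

omit [StandardFrechetSpace F] in
theorem radialNorm_smul_le (a : ℝ) (v : F) : radialNorm (a • v) ≤ ‖a‖ₑ * radialNorm v := by
  rw [radialNorm_le_iff]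
  intro s
  rw [smul_smul]
  refine (metricNorm_smul_le _ _).trans_eq ?_
  rw [enorm_mul]
  ring

omit [StandardFrechetSpace F] in
theorem radialNorm_smul (a : ℝ) (v : F) : radialNorm (a • v) = ‖a‖ₑ * radialNorm v := by
  refine le_antisymm (radialNorm_smul_le a v) ?_
  by_cases ha : a = 0
  · simp [ha]
  have h := radialNorm_smul_le a⁻¹ (a • v)
  rw [inv_smul_smul₀ ha] at h
  calc ‖a‖ₑ * radialNorm v ≤ ‖a‖ₑ * (‖a⁻¹‖ₑ * radialNorm (a • v)) := by gcongr
    _ = radialNorm (a • v) := by rw [← mul_assoc, ← enorm_mul, mul_inv_cancel₀ ha]; simp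

omit [StandardFrechetSpace F] in
theorem radialNorm_neg (v : F) : radialNorm (-v) = radialNorm v := by
  have h := radialNorm_smul (-1) v
  simpa using h

omit [StandardFrechetSpace F] in
theorem radialNorm_sub_comm (v w : F) : radialNorm (v - w) = radialNorm (w - v) := by
  rw [← radialNorm_neg, neg_sub]

theorem radialNorm_sub_le (v w : F) : radialNorm (v - w) ≤ radialNorm v + radialNorm w := by
  rw [sub_eq_add_neg, ← radialNorm_neg w]
  exact radialNorm_add_le _ _

omit [StandardFrechetSpace F] in
-- `L` commutes with scalars, so its Lipschitz bound applies along the whole line through `v`. This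
-- is what transfers bounds on `P'` from the metric to the radial norm.
theorem radialNorm_map_le (L : F →ₗ[ℝ] F) (v : F) :
    radialNorm (L v) ≤ lipNorm (metricNorm F) L * radialNorm v := by
  rw [radialNorm_le_iff]
  intro s
  rw [← map_smul, mul_assoc]
  exact (le_lipNorm_mul metricNorm_zero L _).trans (by gcongr; exact metricNorm_smul_le s v)

/-- The bound is a family of closed conditions indexed by `s`, so `radialNorm` is lower
semicontinuous on `F`. Closedness feeds the mean value theorem, the Baire argument and the
completeness of `LipVec F`. -/
theorem isClosed_radialNorm_le (C : ℝ≥0∞) : IsClosed {v : F | radialNorm v ≤ C} := by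
  have h : {v : F | radialNorm v ≤ C} = ⋂ s : ℝ, {v | metricNorm F (s • v) ≤ C * ‖s‖ₑ} := by
    ext v
    simp [radialNorm_le_iff]
  rw [h]
  exact isClosed_iInter fun s =>
    isClosed_le (continuous_metricNorm.comp (continuous_const_smul s)) continuous_const

theorem convex_radialNorm_le (C : ℝ≥0∞) : Convex ℝ {v : F | radialNorm v ≤ C} := by
  intro v hv w hw a b ha hb hab
  change radialNorm v ≤ C at hv
  change radialNorm w ≤ C at hw
  change radialNorm _ ≤ C
  calc radialNorm (a • v + b • w) ≤ ‖a‖ₑ * radialNorm v + ‖b‖ₑ * radialNorm w := by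
        rw [← radialNorm_smul, ← radialNorm_smul]; exact radialNorm_add_le _ _
    _ ≤ ‖a‖ₑ * C + ‖b‖ₑ * C := by gcongr
    _ = C := by
        rw [← add_mul, Real.enorm_of_nonneg ha, Real.enorm_of_nonneg hb,
          ← ENNReal.ofReal_add ha hb, hab, ENNReal.ofReal_one, one_mul]

/-- Mean value inequality for the radial norm. -/
theorem radialNorm_sub_le_of_velocity {c c' : ℝ → F} {a b : ℝ} (hab : a ≤ b)
    (hc : ContinuousOn c (Icc a b)) (hc' : ∀ t ∈ Ioo a b, HasVelocity c t (c' t)) {C : ℝ≥0∞}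
    (hC : ∀ t ∈ Ioo a b, radialNorm (c' t) ≤ C) :
    radialNorm (c b - c a) ≤ C * ENNReal.ofReal (b - a) := by
  rcases hab.eq_or_lt with rfl | hlt
  · simp [radialNorm_zero]
  have h := slope_mem_of_velocity_mem hlt hc hc' (convex_radialNorm_le C)
    (isClosed_radialNorm_le C) hC
  have hne : b - a ≠ 0 := (sub_pos.2 hlt).ne'
  rw [← smul_inv_smul₀ hne (c b - c a), radialNorm_smul,
    Real.enorm_of_nonneg (sub_pos.2 hlt).le, mul_comm]
  gcongr
  exact h

end RadialNorm

/-! ### `MC^1`-maps: local Lipschitz estimate and chain rule. -/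

section MCOne

variable {F : Type u} [AddCommGroup F] [Module ℝ F] [MetricSpace F] [StandardFrechetSpace F]

theorem qContinuousOn_iff {E : Type v} [AddCommGroup E] [Module ℝ E] [MetricSpace E] {P : E → F}
    {U : Set E} : QContinuousOn (metricNorm F) U P ↔ ContinuousOn P U := by
  refine forall₂_congr fun x _ => ?_
  rw [ContinuousWithinAt, tendsto_iff_edist_tendsto_0]
  simp only [metricNorm_sub]

/-- `P` is `MC^1` on the open set `U` with derivative `P'`. -/
structure HasMCDerivOn {E : Type v} [AddCommGroup E] [Module ℝ E] [MetricSpace E] (P : E → F)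
    (P' : E → E →ₗ[ℝ] F) (U : Set E) : Prop where
  isOpen : IsOpen U
  continuousOn : ContinuousOn P U
  lipNorm_lt : ∀ x ∈ U, lipNorm (metricNorm F) (P' x) < ∞
  hasDirDeriv : ∀ x ∈ U, ∀ h, HasDirDeriv (metricNorm F) P x h (P' x h)
  tendsto_deriv : ∀ x ∈ U, Tendsto (fun y => lipNorm (metricNorm F) (P' y - P' x)) (𝓝 x) (𝓝 0)

/-- Only level `1` of the hierarchy is needed. Its local clause, evaluated at the centre `x₀` of the
neighbourhood, is the continuity of `P'` at `x₀`. -/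
theorem exists_hasMCDerivOn {E : Type u} [AddCommGroup E] [Module ℝ E] [MetricSpace E]
    {F : Type (max u v)} [AddCommGroup F] [Module ℝ F] [MetricSpace F] [StandardFrechetSpace F]
    {k : ℕ∞} (hk : 1 ≤ k) {U : Set E} (hU : IsOpen U) {P : E → F} (h : IsMCOn.{u, v} k U P) :
    ∃ P', HasMCDerivOn P P' U := by
  obtain ⟨h1, P', h2, h3⟩ := h 1 (by exact_mod_cast hk)
  refine ⟨P', hU, qContinuousOn_iff.1 h1, fun x hx => (h2 x hx).1, fun x hx => (h2 x hx).2,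
    fun x hx => ?_⟩
  obtain ⟨V, hV, -, hxV, -, h4⟩ := h3 x hx
  have h5 := h4 x hxV
  rw [hV.nhdsWithin_eq hxV] at h5
  simpa using h5

theorem HasMCDerivOn.exists_ball {P : F → F} {P' : F → F →ₗ[ℝ] F} {U : Set F}
    (h : HasMCDerivOn P P' U) {x : F} (hx : x ∈ U) : ∃ r > 0, ∃ K : ℝ≥0∞, K ≠ ∞ ∧
      Metric.ball x r ⊆ U ∧ ∀ y ∈ Metric.ball x r, lipNorm (metricNorm F) (P' y) ≤ K := by
  have h1 : ∀ᶠ y in 𝓝 x, y ∈ U ∧ lipNorm (metricNorm F) (P' y - P' x) < 1 :=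
    (h.isOpen.eventually_mem hx).and ((h.tendsto_deriv x hx).eventually_lt_const one_pos)
  obtain ⟨r, hr, h2⟩ := Metric.eventually_nhds_iff_ball.1 h1
  refine ⟨r, hr, 1 + lipNorm (metricNorm F) (P' x),
    ENNReal.add_ne_top.2 ⟨ENNReal.one_ne_top, (h.lipNorm_lt x hx).ne⟩, fun y hy => (h2 y hy).1,
    fun y hy => ?_⟩
  have h3 := lipNorm_add_le (metricNorm_zero (F := F)) metricNorm_add_le (P' y - P' x) (P' x)
  rw [sub_add_cancel] at h3
  exact h3.trans (by gcongr; exact (h2 y hy).2.le)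

/-- `MC^1`-maps are locally Lipschitz for the radial norm. -/
theorem HasMCDerivOn.radialNorm_sub_le {P : F → F} {P' : F → F →ₗ[ℝ] F} {U B : Set F}
    (h : HasMCDerivOn P P' U) (hBU : B ⊆ U) (hB : Convex ℝ B) {K : ℝ≥0∞}
    (hK : ∀ y ∈ B, lipNorm (metricNorm F) (P' y) ≤ K) {y z : F} (hy : y ∈ B) (hz : z ∈ B) :
    radialNorm (P y - P z) ≤ K * radialNorm (y - z) := by
  have hmem : ∀ θ ∈ Icc (0 : ℝ) 1, z + θ • (y - z) ∈ B := fun θ hθ =>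
    hB.add_smul_sub_mem hz hy hθ
  have hcont : ContinuousOn (fun θ : ℝ => P (z + θ • (y - z))) (Icc 0 1) :=
    h.continuousOn.comp (by fun_prop) fun θ hθ => hBU (hmem θ hθ)
  have h1 := radialNorm_sub_le_of_velocity (zero_le_one' ℝ) hcont
    (c' := fun θ => P' (z + θ • (y - z)) (y - z)) (C := K * radialNorm (y - z))
    (fun θ hθ => (h.hasDirDeriv _ (hBU (hmem θ (Ioo_subset_Icc_self hθ))) _).hasVelocity)
    fun θ hθ => (radialNorm_map_le _ _).trans (by
      gcongr; exact hK _ (hmem θ (Ioo_subset_Icc_self hθ)))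
  simpa using h1

/-- Chain rule for an `MC^1`-map and a curve. -/
theorem HasMCDerivOn.hasVelocity_comp {P : F → F} {P' : F → F →ₗ[ℝ] F} {U : Set F}
    (h : HasMCDerivOn P P' U) {c : ℝ → F} {t : ℝ} {v : F} (hc : HasVelocity c t v)
    (ht : c t ∈ U) : HasVelocity (fun s => P (c s)) t (P' (c t) v) := by
  obtain ⟨r, hr, K, hK, hBU, hKB⟩ := h.exists_ball ht
  set x := c t
  have hcc := hc.continuousAt
  rw [hasVelocity_iff_tendsto] at hc ⊢
  have hs : Tendsto (fun s : ℝ => t + s) (𝓝[≠] 0) (𝓝 t) := by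
    have h1 := (continuous_const_add t).tendsto 0
    rw [add_zero] at h1
    exact h1.mono_left nhdsWithin_le_nhds
  have hcs : Tendsto (fun s => c (t + s)) (𝓝[≠] 0) (𝓝 x) := hcc.tendsto.comp hs
  rw [EMetric.tendsto_nhds]
  intro ε hε
  obtain ⟨δ, hδ, hδε⟩ : ∃ δ : ℝ, 0 < δ ∧ ENNReal.ofReal δ < ε := by
    obtain ⟨δ, -, h0, h1⟩ := ENNReal.lt_iff_exists_real_btwn.1 hε
    exact ⟨δ, by simpa using h0, h1⟩
  have hlim1 : Tendsto (fun s => K * edist (s⁻¹ • (c (t + s) - x)) v) (𝓝[≠] 0) (𝓝 0) := by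
    have h1 := ENNReal.Tendsto.const_mul (tendsto_iff_edist_tendsto_0.1 hc) (Or.inr hK)
    simpa using h1
  have hlim2 : Tendsto (fun y => lipNorm (metricNorm F) (P' y - P' x) * metricNorm F v) (𝓝 x)
      (𝓝 0) := by
    have h1 := ENNReal.Tendsto.mul_const (h.tendsto_deriv x ht)
      (Or.inr (edist_ne_top v 0) : _ ∨ metricNorm F v ≠ ∞)
    simpa using h1
  have hδ2 : 0 < ENNReal.ofReal (δ / 2) := by simpa using hδ
  obtain ⟨ρ, hρ, hρ2⟩ := Metric.eventually_nhds_iff_ball.1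
    ((hlim2.eventually_lt_const hδ2).and (Metric.ball_mem_nhds x hr))
  filter_upwards [hlim1.eventually_lt_const hδ2, hcs.eventually (Metric.ball_mem_nhds x hρ),
    self_mem_nhdsWithin] with s hs1 hs2 hs0
  set w := s⁻¹ • (c (t + s) - x)
  have hsw : s • w = c (t + s) - x := smul_inv_smul₀ hs0 _
  have hmem : ∀ θ ∈ Icc (0 : ℝ) 1, x + θ • (s • w) ∈ Metric.ball x ρ := by
    intro θ hθ
    rw [hsw]
    exact (convex_ball_of_standard x ρ).add_smul_sub_mem (Metric.mem_ball_self hρ) hs2 hθ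
  -- The factor `s⁻¹` is put inside before the mean value theorem is applied: the metric is not
  -- homogeneous, so an estimate for the increment of `P` could not be divided by `s` afterwards.
  have hvel : ∀ θ ∈ Ioo (0 : ℝ) 1, HasVelocity
      (fun θ => s⁻¹ • P (x + θ • (s • w)) - θ • P' x v) θ
      (P' (x + θ • (s • w)) w - P' x v) := by
    intro θ hθ
    have h1 := ((h.hasDirDeriv _ (hBU (hρ2 _ (hmem θ (Ioo_subset_Icc_self hθ))).2)
      (s • w)).hasVelocity).const_smul s⁻¹
    rw [map_smul, inv_smul_smul₀ hs0] at h1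
    exact h1.sub (hasVelocity_smul_const _ _)
  have hcont : ContinuousOn (fun θ : ℝ => s⁻¹ • P (x + θ • (s • w)) - θ • P' x v) (Icc 0 1) := by
    have h1 : ContinuousOn (fun θ : ℝ => P (x + θ • (s • w))) (Icc 0 1) :=
      h.continuousOn.comp (by fun_prop) fun θ hθ => hBU (hρ2 _ (hmem θ hθ)).2
    exact (h1.const_smul _).sub (by fun_prop)
  have hbd : ∀ θ ∈ Ioo (0 : ℝ) 1, P' (x + θ • (s • w)) w - P' x v ∈ Metric.closedBall 0 δ := by
    intro θ hθ
    have hy := hρ2 _ (hmem θ (Ioo_subset_Icc_self hθ))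
    set y := x + θ • (s • w)
    -- The two summands are small for different reasons: `w` is close to `v` while `P' y` has
    -- Lipschitz norm at most `K`, and `P' y` is close to `P' x`.
    have h1 : P' y w - P' x v = P' y (w - v) + (P' y - P' x) v := by
      rw [map_sub, LinearMap.sub_apply]; abel
    have h2 : metricNorm F (P' y w - P' x v) ≤ ENNReal.ofReal δ := by
      calc metricNorm F (P' y w - P' x v)
          ≤ metricNorm F (P' y (w - v)) + metricNorm F ((P' y - P' x) v) := by
            rw [h1]; exact metricNorm_add_le _ _
        _ ≤ K * edist w v + lipNorm (metricNorm F) (P' y - P' x) * metricNorm F v := by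
            refine add_le_add ?_ (le_lipNorm_mul metricNorm_zero _ _)
            rw [← metricNorm_sub w v]
            exact (le_lipNorm_mul metricNorm_zero _ _).trans (by gcongr; exact hKB y hy.2)
        _ ≤ ENNReal.ofReal (δ / 2) + ENNReal.ofReal (δ / 2) := add_le_add hs1.le hy.1.le
        _ = ENNReal.ofReal δ := by
            rw [← ENNReal.ofReal_add (by positivity) (by positivity), add_halves]
    rw [Metric.mem_closedBall]
    rwa [metricNorm, edist_dist, ENNReal.ofReal_le_ofReal_iff hδ.le] at h2
  have hfin := slope_mem_of_velocity_mem one_pos hcont hvel (convex_closedBall_of_standard 0 δ)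
    Metric.isClosed_closedBall hbd
  have heq : (1 - 0 : ℝ)⁻¹ • ((s⁻¹ • P (x + (1 : ℝ) • (s • w)) - (1 : ℝ) • P' x v) -
      (s⁻¹ • P (x + (0 : ℝ) • (s • w)) - (0 : ℝ) • P' x v)) =
      s⁻¹ • (P (c (t + s)) - P x) - P' x v := by
    simp only [sub_zero, inv_one, one_smul, zero_smul, add_zero, hsw, add_sub_cancel, smul_sub]
    abel
  have hfin' : s⁻¹ • (P (c (t + s)) - P x) - P' x v ∈ Metric.closedBall 0 δ := by
    rw [← heq]; exact hfin
  rw [Metric.mem_closedBall, dist_sub_zero_eq] at hfin'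
  rw [edist_dist]
  exact (ENNReal.ofReal_le_ofReal hfin').trans_lt hδε

end MCOne

/-! ### From a conditional Harnack inequality to boundedness, by Baire category. -/

section Boundedness

/-- A finite lower semicontinuous function on `[A, B]` that satisfies a Harnack inequality on each
interval on which it is bounded, is bounded. -/
theorem exists_bound_of_harnack {u : ℝ → ℝ≥0∞} {A B : ℝ}
    (hfin : ∀ t ∈ Icc A B, u t ≠ ∞) (hlsc : ∀ C, IsClosed {t | t ∈ Icc A B ∧ u t ≤ C})
    (H : ∀ a b, A ≤ a → b ≤ B → (∃ N : ℝ≥0∞, N ≠ ∞ ∧ ∀ t ∈ Icc a b, u t ≤ N) →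
      ∀ s ∈ Icc a b, ∀ t ∈ Icc a b, u t ≤ 2 * u s) :
    ∃ N : ℝ≥0∞, N ≠ ∞ ∧ ∀ t ∈ Icc A B, u t ≤ N := by
  let bdd : Set ℝ → Prop := fun S => ∃ N : ℝ≥0∞, N ≠ ∞ ∧ ∀ t ∈ S, t ∈ Icc A B → u t ≤ N
  have bdd_mono : ∀ {S T}, S ⊆ T → bdd T → bdd S := fun hST ⟨N, hN, h⟩ =>
    ⟨N, hN, fun t ht => h t (hST ht)⟩
  have bdd_compact : ∀ S, IsCompact S → (∀ x ∈ S, ∃ V ∈ 𝓝 x, bdd V) → bdd S := by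
    intro S hS h
    refine hS.induction_on (p := bdd) ⟨0, by simp, by simp⟩ (fun S T hST => bdd_mono hST) ?_ ?_
    · rintro S T ⟨N, hN, h1⟩ ⟨N', hN', h2⟩
      refine ⟨max N N', (max_lt hN.lt_top hN'.lt_top).ne, ?_⟩
      rintro t (ht | ht) hI
      · exact (h1 t ht hI).trans (le_max_left _ _)
      · exact (h2 t ht hI).trans (le_max_right _ _)
    · intro x hx
      obtain ⟨V, hV, hb⟩ := h x hx
      exact ⟨V, mem_nhdsWithin_of_mem_nhds hV, hb⟩
  suffices hall : ∀ x ∈ Icc A B, ∃ V ∈ 𝓝 x, bdd V by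
    obtain ⟨N, hN, h⟩ := bdd_compact _ isCompact_Icc hall
    exact ⟨N, hN, fun t ht => h t ht ht⟩
  by_contra hcon
  push Not at hcon
  -- `T` is the set of points near which `u` is unbounded. It is closed, hence a Baire space if
  -- nonempty, and finiteness of `u` covers it by the closed sets `{u ≤ n}`.
  set T : Set ℝ := {x | x ∈ Icc A B ∧ ∀ V ∈ 𝓝 x, ¬ bdd V}
  have hTc : IsClosed T := by
    have h1 : IsClosed {x | ∀ V ∈ 𝓝 x, ¬ bdd V} := by
      rw [← isOpen_compl_iff, isOpen_iff_mem_nhds]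
      intro x hx
      simp only [mem_compl_iff, mem_ofPred_eq, not_forall, not_not] at hx
      obtain ⟨V, hV, hb⟩ := hx
      filter_upwards [eventually_mem_nhds_iff.2 hV] with y hy
      simp only [mem_compl_iff, mem_ofPred_eq, not_forall, not_not]
      exact ⟨V, hy, hb⟩
    exact isClosed_Icc.inter h1
  have : Nonempty T := let ⟨x, hx, h⟩ := hcon; ⟨⟨x, hx, h⟩⟩
  have : CompleteSpace T := hTc.completeSpace_coe
  obtain ⟨n, ⟨t₁, ht₁⟩, hn⟩ := nonempty_interior_of_iUnion_of_closed
    (f := fun n : ℕ => {t : T | u t ≤ n})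
    (fun n => by
      convert (hlsc n).preimage (continuous_subtype_val (p := (· ∈ T))) using 1
      ext t
      exact ⟨fun h => ⟨t.2.1, h⟩, fun h => h.2⟩)
    (by
      ext t
      simp only [mem_iUnion, mem_univ, iff_true]
      obtain ⟨n, hn⟩ := ENNReal.exists_nat_gt (hfin t t.2.1)
      exact ⟨n, hn.le⟩)
  rw [mem_interior_iff_mem_nhds, Metric.mem_nhds_iff] at hn
  obtain ⟨ε, hε, hn⟩ := hn
  have hTn : ∀ t ∈ T, t ∈ Metric.ball t₁ ε → u t ≤ n := fun t ht htb => @hn ⟨t, ht⟩ htb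
  have hnotT : ∀ t ∈ Icc A B, t ∉ T → ∃ V ∈ 𝓝 t, bdd V := by
    intro t ht hnt
    by_contra h
    push Not at h
    exact hnt ⟨ht, h⟩
  -- The contradiction: `u` is bounded by `2 * n` on the whole ball around `t₁ ∈ T`. Off `T`, this
  -- comes from comparison with the nearest point `t₂` of `T` in the direction of `t₁`.
  refine ht₁.2 _ (Metric.ball_mem_nhds t₁ hε) ⟨2 * n, by finiteness, fun t ht htI => ?_⟩
  by_cases htT : t ∈ T
  · refine (hTn t htT ht).trans ?_
    rw [two_mul]; exact le_self_add
  rcases le_total t t₁ with hle | hle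
  · set S := T ∩ Icc t t₁
    have hSc : IsCompact S := isCompact_Icc.inter_left hTc
    have hSne : S.Nonempty := ⟨t₁, ht₁, hle, le_rfl⟩
    obtain ⟨t₂, ⟨ht₂T, ht₂⟩, hmin⟩ := hSc.exists_isLeast hSne
    -- The interval `[t, b]` misses `T`, so `u` is bounded on it by compactness and the Harnack
    -- inequality applies. The resulting bound `2 * u t` does not depend on `b`, so `u` is bounded
    -- on `[t, t₂]` too, the endpoint having a finite value.
    have hlt : ∀ b < t₂, t ≤ b → ∀ s ∈ Icc t b, u s ≤ 2 * u t := by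
      intro b hb htb s hs
      refine H t b htI.1 (hb.le.trans ht₂T.1.2) ?_ t ⟨le_rfl, htb⟩ s hs
      obtain ⟨N, hN, h⟩ := bdd_compact (Icc t b) isCompact_Icc fun x hx => by
        refine hnotT x ⟨htI.1.trans hx.1, hx.2.trans (hb.le.trans ht₂T.1.2)⟩ fun hxT => ?_
        have := hmin ⟨hxT, hx.1, hx.2.trans (hb.le.trans ht₂.2)⟩
        linarith [hx.2]
      exact ⟨N, hN, fun x hx => h x hx ⟨htI.1.trans hx.1, hx.2.trans (hb.le.trans ht₂T.1.2)⟩⟩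
    have hb : u t ≤ 2 * u t₂ := by
      refine H t t₂ htI.1 ht₂T.1.2 ⟨max (2 * u t) (u t₂), ?_, ?_⟩ t₂ ⟨ht₂.1, le_rfl⟩ t
        ⟨le_rfl, ht₂.1⟩
      · exact (max_lt (ENNReal.mul_lt_top (by simp) (hfin t htI).lt_top)
          (hfin t₂ ht₂T.1).lt_top).ne
      · intro s hs
        rcases hs.2.eq_or_lt with rfl | hs2
        · exact le_max_right _ _
        · exact (hlt s hs2 hs.1 s ⟨hs.1, le_rfl⟩).trans (le_max_left _ _)
    have hball : t₂ ∈ Metric.ball t₁ ε := by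
      rw [Metric.mem_ball, Real.dist_eq, abs_lt] at ht ⊢
      constructor <;> linarith [ht₂.1, ht₂.2, ht.1]
    have hn2 := hTn t₂ ht₂T hball
    exact hb.trans (by gcongr)
  · set S := T ∩ Icc t₁ t
    have hSc : IsCompact S := isCompact_Icc.inter_left hTc
    have hSne : S.Nonempty := ⟨t₁, ht₁, le_rfl, hle⟩
    obtain ⟨t₂, ⟨ht₂T, ht₂⟩, hmax⟩ := hSc.exists_isGreatest hSne
    have hlt : ∀ a, t₂ < a → a ≤ t → ∀ s ∈ Icc a t, u s ≤ 2 * u t := by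
      intro a ha hat s hs
      refine H a t (ht₂T.1.1.trans ha.le) htI.2 ?_ t ⟨hat, le_rfl⟩ s hs
      obtain ⟨N, hN, h⟩ := bdd_compact (Icc a t) isCompact_Icc fun x hx => by
        refine hnotT x ⟨(ht₂T.1.1.trans ha.le).trans hx.1, hx.2.trans htI.2⟩ fun hxT => ?_
        have := hmax ⟨hxT, (ht₂.1.trans ha.le).trans hx.1, hx.2⟩
        linarith [hx.1]
      exact ⟨N, hN, fun x hx => h x hx ⟨(ht₂T.1.1.trans ha.le).trans hx.1, hx.2.trans htI.2⟩⟩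
    have hb : u t ≤ 2 * u t₂ := by
      refine H t₂ t ht₂T.1.1 htI.2 ⟨max (2 * u t) (u t₂), ?_, ?_⟩ t₂ ⟨le_rfl, ht₂.2⟩ t
        ⟨ht₂.2, le_rfl⟩
      · exact (max_lt (ENNReal.mul_lt_top (by simp) (hfin t htI).lt_top)
          (hfin t₂ ht₂T.1).lt_top).ne
      · intro s hs
        rcases hs.1.eq_or_lt with rfl | hs2
        · exact le_max_right _ _
        · exact (hlt s hs2 hs.2 s ⟨le_rfl, hs.2⟩).trans (le_max_left _ _)
    have hball : t₂ ∈ Metric.ball t₁ ε := by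
      rw [Metric.mem_ball, Real.dist_eq, abs_lt] at ht ⊢
      constructor <;> linarith [ht₂.1, ht₂.2, ht.2]
    have hn2 := hTn t₂ ht₂T hball
    exact hb.trans (by gcongr)

end Boundedness

/-! ### Radial regularity of integral curves and local uniqueness. -/

section LocalUniqueness

variable {F : Type u} [AddCommGroup F] [Module ℝ F] [MetricSpace F] [StandardFrechetSpace F]

theorem radialNorm_sub_le_of_velocity_Icc {c c' : ℝ → F} {A B : ℝ}
    (hc' : ∀ t ∈ Icc A B, HasVelocity c t (c' t)) {C : ℝ≥0∞}
    (hC : ∀ t ∈ Icc A B, radialNorm (c' t) ≤ C) {s t : ℝ} (hs : s ∈ Icc A B) (ht : t ∈ Icc A B) :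
    radialNorm (c t - c s) ≤ C * ENNReal.ofReal |t - s| := by
  have key : ∀ {s t}, s ∈ Icc A B → t ∈ Icc A B → s ≤ t →
      radialNorm (c t - c s) ≤ C * ENNReal.ofReal |t - s| := by
    intro s t hs ht hst
    have hsub : Icc s t ⊆ Icc A B := Icc_subset_Icc hs.1 ht.2
    rw [abs_of_nonneg (sub_nonneg.2 hst)]
    exact radialNorm_sub_le_of_velocity hst
      (fun x hx => (hc' x (hsub hx)).continuousAt.continuousWithinAt)
      (fun x hx => hc' x (hsub (Ioo_subset_Icc_self hx)))
      fun x hx => hC x (hsub (Ioo_subset_Icc_self hx))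
  rcases le_total s t with h | h
  · exact key hs ht h
  · rw [radialNorm_sub_comm, abs_sub_comm]
    exact key ht hs h

theorem exists_small_mul {K : ℝ≥0∞} (hK : K ≠ ∞) :
    ∃ δ > 0, ∀ x ≤ δ, K * ENNReal.ofReal x ≤ 2⁻¹ := by
  refine ⟨(2 * (K.toReal + 1))⁻¹, by positivity, fun x hx => ?_⟩
  have h2 : (2⁻¹ : ℝ≥0∞) = ENNReal.ofReal 2⁻¹ := by
    rw [ENNReal.ofReal_inv_of_pos two_pos]; norm_num
  rw [← ENNReal.ofReal_toReal hK, ← ENNReal.ofReal_mul ENNReal.toReal_nonneg, h2]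
  refine ENNReal.ofReal_le_ofReal ?_
  have hp : 0 ≤ K.toReal := ENNReal.toReal_nonneg
  calc K.toReal * x ≤ (K.toReal + 1) * (2 * (K.toReal + 1))⁻¹ := by
        rcases le_total x 0 with h | h
        · exact (mul_nonpos_of_nonneg_of_nonpos hp h).trans (by positivity)
        · gcongr; linarith
    _ = 2⁻¹ := by field_simp

variable {X : F → F} {X' : F → F →ₗ[ℝ] F} {U : Set F}

/-- The radial norm of the velocity of an integral curve is locally bounded. -/
theorem HasMCDerivOn.exists_radialNorm_velocity_le (h : HasMCDerivOn X X' U)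
    (hX : ∀ x, radialNorm (X x) ≠ ∞) {c : ℝ → F} {t₀ : ℝ}
    (hc : ∀ᶠ t in 𝓝 t₀, c t ∈ U ∧ HasVelocity c t (X (c t))) :
    ∃ S : ℝ≥0∞, S ≠ ∞ ∧ ∀ᶠ t in 𝓝 t₀, radialNorm (X (c t)) ≤ S := by
  obtain ⟨r, hr, K, hK, hBU, hKB⟩ := h.exists_ball hc.self_of_nhds.1
  obtain ⟨δ, hδ, hδK⟩ := exists_small_mul hK
  have hcont := hc.self_of_nhds.2.continuousAt
  obtain ⟨ρ, hρ, hρc⟩ := Metric.nhds_basis_closedBall.eventually_iff.1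
    (hc.and (hcont.eventually_mem (Metric.ball_mem_nhds (c t₀) hr)))
  -- The interval `[A, B]` has length `2 * η ≤ δ`, so `hδK` applies to any two of its points.
  set η := min ρ (δ / 2)
  have hη0 : 0 < η := lt_min hρ (by positivity)
  set A := t₀ - η
  set B := t₀ + η
  have hI : ∀ t ∈ Icc A B, (c t ∈ U ∧ HasVelocity c t (X (c t))) ∧ c t ∈ Metric.ball (c t₀) r := by
    intro t ht
    refine @hρc t (Metric.closedBall_subset_closedBall (min_le_left ρ (δ / 2)) ?_)
    rw [Real.closedBall_eq_Icc]
    exact ht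
  have hlip : ∀ s ∈ Icc A B, ∀ t ∈ Icc A B,
      radialNorm (X (c t) - X (c s)) ≤ K * radialNorm (c t - c s) := fun s hs t ht =>
    h.radialNorm_sub_le hBU (convex_ball_of_standard _ r) hKB (hI t ht).2 (hI s hs).2
  have hXc : ContinuousOn (fun t => X (c t)) (Icc A B) := fun t ht =>
    ((h.continuousOn.continuousAt (h.isOpen.mem_nhds (hI t ht).1.1)).comp
      (hI t ht).1.2.continuousAt).continuousWithinAt
  obtain ⟨S, hS, hSb⟩ := exists_bound_of_harnack (u := fun t => radialNorm (X (c t)))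
    (A := A) (B := B) (fun t _ => hX _)
    (fun C => hXc.preimage_isClosed_of_isClosed isClosed_Icc (isClosed_radialNorm_le C)) (by
      rintro a b ha hb ⟨N, hN, hbd⟩ s hs t ht
      have hsub : Icc a b ⊆ Icc A B := Icc_subset_Icc ha hb
      set S : ℝ≥0∞ := ⨆ x ∈ Icc a b, radialNorm (X (c x))
      have hSN : S ≠ ∞ := ((iSup₂_le hbd).trans_lt hN.lt_top).ne
      have hle : ∀ x ∈ Icc a b, radialNorm (X (c x)) ≤ S := fun x hx =>
        le_iSup₂ (f := fun x (_ : x ∈ Icc a b) => radialNorm (X (c x))) x hx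
      -- The velocity varies by at most `K * S * |x - s| ≤ S / 2`. Since `S` is finite on `[a, b]`,
      -- the term `S / 2` can be absorbed, which gives the factor `2`.
      have h1 : S ≤ radialNorm (X (c s)) + S / 2 := by
        refine iSup₂_le fun x hx => ?_
        have h2 := radialNorm_add_le (X (c s)) (X (c x) - X (c s))
        rw [add_sub_cancel] at h2
        refine h2.trans (add_le_add le_rfl ?_)
        calc radialNorm (X (c x) - X (c s)) ≤ K * (S * ENNReal.ofReal |x - s|) :=
              (hlip s (hsub hs) x (hsub hx)).trans (by
                gcongr
                exact radialNorm_sub_le_of_velocity_Icc (c' := fun t => X (c t))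
                  (fun y hy => (hI y (hsub hy)).1.2) hle hs hx)
          _ = S * (K * ENNReal.ofReal |x - s|) := by ring
          _ ≤ S * 2⁻¹ := by
              gcongr
              refine hδK _ ?_
              have h3 := hsub hs
              have h4 := hsub hx
              have h5 : η ≤ δ / 2 := min_le_right _ _
              rw [abs_le]
              constructor <;> linarith [h3.1, h3.2, h4.1, h4.2]
      have h2 : S / 2 ≤ radialNorm (X (c s)) := by
        refine ENNReal.le_of_add_le_add_right (a := S / 2)
          (ENNReal.div_lt_top hSN two_ne_zero).ne ?_
        rwa [ENNReal.add_halves]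
      calc radialNorm (X (c t)) ≤ S := hle t ht
        _ = 2 * (S / 2) := by rw [two_mul, ENNReal.add_halves]
        _ ≤ 2 * radialNorm (X (c s)) := by gcongr)
  refine ⟨S, hS, ?_⟩
  filter_upwards [Icc_mem_nhds (show A < t₀ by simp only [A]; linarith)
    (show t₀ < B by simp only [B]; linarith)] with t ht using hSb t ht

/-- Integral curves are locally Lipschitz for the radial norm. -/
theorem HasMCDerivOn.exists_radialNorm_sub_le (h : HasMCDerivOn X X' U)
    (hX : ∀ x, radialNorm (X x) ≠ ∞) {c : ℝ → F} {t₀ : ℝ}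
    (hc : ∀ᶠ t in 𝓝 t₀, c t ∈ U ∧ HasVelocity c t (X (c t))) :
    ∃ S : ℝ≥0∞, S ≠ ∞ ∧
      ∀ᶠ t in 𝓝 t₀, radialNorm (c t - c t₀) ≤ S * ENNReal.ofReal |t - t₀| := by
  obtain ⟨S, hS, hb⟩ := h.exists_radialNorm_velocity_le hX hc
  refine ⟨S, hS, ?_⟩
  obtain ⟨ρ, hρ, hρc⟩ := Metric.nhds_basis_closedBall.eventually_iff.1 (hc.and hb)
  rw [Real.closedBall_eq_Icc] at hρc
  have h0 : t₀ ∈ Icc (t₀ - ρ) (t₀ + ρ) := ⟨by linarith, by linarith⟩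
  filter_upwards [Icc_mem_nhds (show t₀ - ρ < t₀ by linarith) (show t₀ < t₀ + ρ by linarith)]
    with t ht
  exact radialNorm_sub_le_of_velocity_Icc (c' := fun t => X (c t))
    (fun y hy => (hρc hy).1.2) (fun y hy => (hρc hy).2) h0 ht

/-- The field is radially Lipschitz and so is the curve. Since the radial norm of a vector is the
Lipschitz norm of the map `ℝ → F` that it spans, this is the continuity of the derivative required
of an `MC^1`-curve. -/
theorem HasMCDerivOn.tendsto_radialNorm_velocity (h : HasMCDerivOn X X' U)
    (hX : ∀ x, radialNorm (X x) ≠ ∞) {c : ℝ → F} {t₀ : ℝ}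
    (hc : ∀ᶠ t in 𝓝 t₀, c t ∈ U ∧ HasVelocity c t (X (c t))) :
    Tendsto (fun t => radialNorm (X (c t) - X (c t₀))) (𝓝 t₀) (𝓝 0) := by
  obtain ⟨r, hr, K, hK, hBU, hKB⟩ := h.exists_ball hc.self_of_nhds.1
  obtain ⟨S, hS, hSb⟩ := h.exists_radialNorm_sub_le hX hc
  have hcont := hc.self_of_nhds.2.continuousAt
  have hlim : Tendsto (fun t => K * (S * ENNReal.ofReal |t - t₀|)) (𝓝 t₀) (𝓝 0) := by
    have h1 : Tendsto (fun t => ENNReal.ofReal |t - t₀|) (𝓝 t₀) (𝓝 (ENNReal.ofReal |t₀ - t₀|)) :=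
      (ENNReal.continuous_ofReal.comp (by fun_prop : Continuous fun t => |t - t₀|)).tendsto t₀
    have h2 := ENNReal.Tendsto.const_mul (ENNReal.Tendsto.const_mul h1 (Or.inr hS)) (Or.inr hK)
    simpa using h2
  refine tendsto_of_tendsto_of_tendsto_of_le_of_le' tendsto_const_nhds hlim
    (Eventually.of_forall fun _ => zero_le) ?_
  filter_upwards [hSb, hcont.eventually_mem (Metric.ball_mem_nhds (c t₀) hr)] with t ht htb
  refine (h.radialNorm_sub_le hBU (convex_ball_of_standard _ r) hKB htb
    (Metric.mem_ball_self hr)).trans ?_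
  gcongr

theorem HasMCDerivOn.eventuallyEq_of_velocity (h : HasMCDerivOn X X' U)
    (hX : ∀ x, radialNorm (X x) ≠ ∞) {c₁ c₂ : ℝ → F} {t₀ : ℝ}
    (hc₁ : ∀ᶠ t in 𝓝 t₀, c₁ t ∈ U ∧ HasVelocity c₁ t (X (c₁ t)))
    (hc₂ : ∀ᶠ t in 𝓝 t₀, c₂ t ∈ U ∧ HasVelocity c₂ t (X (c₂ t))) (h0 : c₁ t₀ = c₂ t₀) :
    c₁ =ᶠ[𝓝 t₀] c₂ := by
  obtain ⟨r, hr, K, hK, hBU, hKB⟩ := h.exists_ball hc₁.self_of_nhds.1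
  obtain ⟨δ, hδ, hδK⟩ := exists_small_mul hK
  have hcont₁ := hc₁.self_of_nhds.2.continuousAt
  have hcont₂ := hc₂.self_of_nhds.2.continuousAt
  obtain ⟨S₁, hS₁, hb₁⟩ := h.exists_radialNorm_sub_le hX hc₁
  obtain ⟨S₂, hS₂, hb₂⟩ := h.exists_radialNorm_sub_le hX hc₂
  have hball := Metric.ball_mem_nhds (c₁ t₀) hr
  obtain ⟨ρ, hρ, hρc⟩ := Metric.nhds_basis_closedBall.eventually_iff.1
    (((hc₁.and hc₂).and (hb₁.and hb₂)).and ((hcont₁.eventually_mem hball).and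
      (hcont₂.eventually_mem (by rwa [← h0]))))
  set η := min ρ δ
  have hη0 : 0 < η := lt_min hρ hδ
  have hI := fun t (ht : t ∈ Icc (t₀ - η) (t₀ + η)) => @hρc t (by
    refine Metric.closedBall_subset_closedBall (min_le_left ρ δ) ?_
    rw [Real.closedBall_eq_Icc]
    exact ht)
  have habs : ∀ t ∈ Icc (t₀ - η) (t₀ + η), |t - t₀| ≤ η := fun t ht => by
    rw [abs_le]; constructor <;> linarith [ht.1, ht.2]
  have ht₀ : t₀ ∈ Icc (t₀ - η) (t₀ + η) := ⟨by linarith, by linarith⟩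
  set D : ℝ≥0∞ := ⨆ t ∈ Icc (t₀ - η) (t₀ + η), radialNorm (c₁ t - c₂ t)
  have hle : ∀ t ∈ Icc (t₀ - η) (t₀ + η), radialNorm (c₁ t - c₂ t) ≤ D := fun t ht =>
    le_iSup₂ (f := fun t (_ : t ∈ Icc (t₀ - η) (t₀ + η)) => radialNorm (c₁ t - c₂ t)) t ht
  -- This is where the radial Lipschitz bounds enter: without finiteness, `D ≤ D / 2` would not
  -- exclude `D = ∞`.
  have hDfin : D ≠ ∞ := by
    have h1 : D ≤ S₁ * ENNReal.ofReal η + S₂ * ENNReal.ofReal η := by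
      refine iSup₂_le fun t ht => ?_
      have h2 : c₁ t - c₂ t = (c₁ t - c₁ t₀) - (c₂ t - c₂ t₀) := by rw [h0]; abel
      rw [h2]
      have h3 := (hI t ht).1.2
      have h4 : ENNReal.ofReal |t - t₀| ≤ ENNReal.ofReal η :=
        ENNReal.ofReal_le_ofReal (habs t ht)
      exact (BoundedFrechet.radialNorm_sub_le _ _).trans
        (add_le_add (h3.1.trans (by gcongr)) (h3.2.trans (by gcongr)))
    exact ne_top_of_le_ne_top (by finiteness) h1
  have hhalf : D ≤ D / 2 := by
    refine iSup₂_le fun t ht => ?_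
    have h1 := radialNorm_sub_le_of_velocity_Icc (c := fun t => c₁ t - c₂ t)
      (c' := fun t => X (c₁ t) - X (c₂ t)) (C := K * D)
      (fun s hs => (hI s hs).1.1.1.2.sub (hI s hs).1.1.2.2)
      (fun s hs => (h.radialNorm_sub_le hBU (convex_ball_of_standard _ r) hKB (hI s hs).2.1
        (hI s hs).2.2).trans (by gcongr; exact hle s hs)) ht₀ ht
    rw [h0, sub_self, sub_zero] at h1
    calc radialNorm (c₁ t - c₂ t) ≤ K * D * ENNReal.ofReal |t - t₀| := h1
      _ = D * (K * ENNReal.ofReal |t - t₀|) := by ring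
      _ ≤ D * 2⁻¹ := by
        gcongr
        exact hδK _ ((habs t ht).trans (min_le_right _ _))
  have hD0 : D = 0 := by
    by_contra hne
    exact absurd hhalf (not_le.2 (ENNReal.half_lt_self hne hDfin))
  filter_upwards [Icc_mem_nhds (show t₀ - η < t₀ by linarith) (show t₀ < t₀ + η by linarith)]
    with t ht
  have h1 := hle t ht
  rw [hD0, nonpos_iff_eq_zero] at h1
  exact sub_eq_zero.1 (eq_zero_of_radialNorm_eq_zero h1)

end LocalUniqueness

/-! ### The Banach space of Lipschitz vectors and local existence. -/

section LocalExistence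

variable (F : Type u) [AddCommGroup F] [Module ℝ F] [MetricSpace F] [StandardFrechetSpace F]

/-- The vectors `v` for which `s ↦ s v` is Lipschitz. -/
def lipVecSubmodule : Submodule ℝ F where
  carrier := {v | radialNorm v ≠ ∞}
  add_mem' {v w} hv hw :=
    ne_top_of_le_ne_top (ENNReal.add_ne_top.2 ⟨hv, hw⟩) (radialNorm_add_le v w)
  zero_mem' := by
    change radialNorm (0 : F) ≠ ∞
    simp [radialNorm_zero]
  smul_mem' a v hv := by
    change radialNorm (a • v) ≠ ∞
    rw [radialNorm_smul]
    exact ENNReal.mul_ne_top enorm_ne_top hv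

/-- The space of Lipschitz vectors, to be normed by `radialNorm`. -/
def LipVec : Type u := lipVecSubmodule F

noncomputable instance : AddCommGroup (LipVec F) :=
  inferInstanceAs (AddCommGroup (lipVecSubmodule F))

noncomputable instance : Module ℝ (LipVec F) := inferInstanceAs (Module ℝ (lipVecSubmodule F))

/-- The inclusion of the Lipschitz vectors. -/
def LipVec.val : LipVec F →ₗ[ℝ] F := (lipVecSubmodule F).subtype

variable {F}

theorem LipVec.radialNorm_ne_top (v : LipVec F) : radialNorm (LipVec.val F v) ≠ ∞ :=
  Subtype.property (p := (· ∈ lipVecSubmodule F)) v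

theorem LipVec.val_injective : Function.Injective (LipVec.val F) :=
  (lipVecSubmodule F).injective_subtype

/-- A Lipschitz vector as an element of `LipVec F`. -/
def LipVec.mk (v : F) (hv : radialNorm v ≠ ∞) : LipVec F :=
  (⟨v, hv⟩ : lipVecSubmodule F)

theorem LipVec.val_mk (v : F) (hv : radialNorm v ≠ ∞) : LipVec.val F (LipVec.mk v hv) = v := rfl

noncomputable instance : Norm (LipVec F) := ⟨fun v => (radialNorm (LipVec.val F v)).toReal⟩

theorem LipVec.norm_def (v : LipVec F) : ‖v‖ = (radialNorm (LipVec.val F v)).toReal := rfl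

theorem LipVec.core : NormedSpace.Core ℝ (LipVec F) where
  norm_nonneg v := ENNReal.toReal_nonneg
  norm_smul a v := by
    rw [norm_def, norm_def, map_smul, radialNorm_smul, ENNReal.toReal_mul, toReal_enorm]
  norm_triangle v w := by
    rw [norm_def, norm_def, norm_def, map_add,
      ← ENNReal.toReal_add v.radialNorm_ne_top w.radialNorm_ne_top]
    exact ENNReal.toReal_mono (ENNReal.add_ne_top.2 ⟨v.radialNorm_ne_top, w.radialNorm_ne_top⟩)
      (radialNorm_add_le _ _)
  norm_eq_zero_iff v := by
    rw [norm_def, ENNReal.toReal_eq_zero_iff, or_iff_left v.radialNorm_ne_top]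
    refine ⟨fun h => LipVec.val_injective ?_, fun h => ?_⟩
    · rw [map_zero]; exact eq_zero_of_radialNorm_eq_zero h
    · rw [h, map_zero, radialNorm_zero]

noncomputable instance : NormedAddCommGroup (LipVec F) := .ofCore LipVec.core

noncomputable instance : NormedSpace ℝ (LipVec F) := .ofCore LipVec.core

theorem LipVec.radialNorm_val (v : LipVec F) : radialNorm (LipVec.val F v) = ‖v‖ₑ := by
  rw [← ofReal_norm, norm_def, ENNReal.ofReal_toReal v.radialNorm_ne_top]

theorem LipVec.edist_val_le (v w : LipVec F) :
    edist (LipVec.val F v) (LipVec.val F w) ≤ edist v w := by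
  rw [← metricNorm_sub, ← map_sub, edist_eq_enorm_sub, ← radialNorm_val]
  exact metricNorm_le_radialNorm _

theorem LipVec.lipschitzWith_val : LipschitzWith 1 (LipVec.val F) := fun v w => by
  simpa using LipVec.edist_val_le v w

/-- A radially Cauchy sequence converges in `F`, and radial balls are closed in `F`, so the Cauchy
estimates pass to the limit. -/
instance : CompleteSpace (LipVec F) := by
  refine Metric.complete_of_cauchySeq_tendsto fun x hx => ?_
  obtain ⟨y, hy⟩ := cauchySeq_tendsto_of_complete
    (LipVec.lipschitzWith_val.uniformContinuous.comp_cauchySeq hx)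
  have key : ∀ ε : ℝ, 0 < ε → ∃ N, ∀ n ≥ N,
      radialNorm (y - LipVec.val F (x n)) ≤ ENNReal.ofReal ε := by
    intro ε hε
    obtain ⟨N, hN⟩ := Metric.cauchySeq_iff.1 hx ε hε
    refine ⟨N, fun n hn => ?_⟩
    refine (isClosed_radialNorm_le (ENNReal.ofReal ε)).mem_of_tendsto
      (hy.sub_const (LipVec.val F (x n))) ?_
    filter_upwards [eventually_ge_atTop N] with m hm
    change radialNorm (LipVec.val F (x m) - LipVec.val F (x n)) ≤ _
    rw [← map_sub, LipVec.radialNorm_val, ← ofReal_norm, ← dist_eq_norm]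
    exact ENNReal.ofReal_le_ofReal (hN m hm n hn).le
  obtain ⟨N, hN⟩ := key 1 one_pos
  have hyfin : radialNorm y ≠ ∞ := by
    have h1 := radialNorm_add_le (y - LipVec.val F (x N)) (LipVec.val F (x N))
    rw [sub_add_cancel] at h1
    refine ne_top_of_le_ne_top (ENNReal.add_ne_top.2
      ⟨ne_top_of_le_ne_top ENNReal.ofReal_ne_top (hN N le_rfl), (x N).radialNorm_ne_top⟩) h1
  refine ⟨LipVec.mk y hyfin, Metric.tendsto_atTop'.2 fun ε hε => ?_⟩
  obtain ⟨N, hN⟩ := key (ε / 2) (by positivity)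
  refine ⟨N, fun n hn => ?_⟩
  have h1 := hN n hn.le
  rw [← LipVec.val_mk y hyfin, ← map_sub, LipVec.radialNorm_val, ← ofReal_norm,
    ENNReal.ofReal_le_ofReal_iff (by positivity), ← dist_eq_norm, dist_comm] at h1
  linarith

theorem HasDerivAt.hasVelocity_val {y : ℝ → LipVec F} {v : LipVec F} {t : ℝ}
    (h : HasDerivAt y v t) (x : F) :
    HasVelocity (fun s => x + LipVec.val F (y s)) t (LipVec.val F v) := by
  rw [hasDerivAt_iff_tendsto_slope_zero] at h
  rw [hasVelocity_iff_tendsto]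
  refine ((LipVec.lipschitzWith_val.continuous.tendsto v).comp h).congr fun s => ?_
  simp

/-- Local existence of integral curves. -/
theorem HasMCDerivOn.exists_velocity {X : F → F} {X' : F → F →ₗ[ℝ] F} {U : Set F}
    (h : HasMCDerivOn X X' U) (hX : ∀ x, radialNorm (X x) ≠ ∞) {x : F} (hx : x ∈ U) (t₀ : ℝ) :
    ∃ c : ℝ → F, c t₀ = x ∧ ∀ᶠ t in 𝓝 t₀, c t ∈ U ∧ HasVelocity c t (X (c t)) := by
  obtain ⟨r, hr, K, hK, hBU, hKB⟩ := h.exists_ball hx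
  lift K to NNReal using hK
  -- With the unknown written as `x + y`, only the displacement `y` has to be a Lipschitz vector;
  -- `x` itself need not be one.
  let g : LipVec F → LipVec F := fun y => LipVec.mk (X (x + LipVec.val F y)) (hX _)
  let a : NNReal := ⟨r / 2, by positivity⟩
  have ha : (a : ℝ) = r / 2 := rfl
  have hmem : ∀ y ∈ Metric.closedBall (0 : LipVec F) a, x + LipVec.val F y ∈ Metric.ball x r := by
    intro y hy
    have h1 := LipVec.lipschitzWith_val.dist_le_mul y 0
    rw [map_zero, NNReal.coe_one, one_mul] at h1
    have h2 : dist (x + LipVec.val F y) x = dist (LipVec.val F y) 0 := by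
      rw [← dist_sub_zero_eq, add_sub_cancel_left]
    rw [Metric.mem_closedBall, ha] at hy
    rw [Metric.mem_ball, h2]
    linarith
  have hlip : LipschitzOnWith K g (Metric.closedBall 0 a) := by
    intro y hy z hz
    have h1 := h.radialNorm_sub_le hBU (convex_ball_of_standard x r) hKB (hmem y hy) (hmem z hz)
    rw [add_sub_add_left_eq_sub, ← map_sub, LipVec.radialNorm_val] at h1
    rw [edist_eq_enorm_sub, edist_eq_enorm_sub, ← LipVec.radialNorm_val (g y - g z), map_sub]
    exact h1
  let L : NNReal := ‖g 0‖₊ + K * a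
  have hL : ∀ y ∈ Metric.closedBall (0 : LipVec F) a, ‖g y‖ ≤ L := by
    intro y hy
    have h1 := hlip.dist_le_mul y hy 0 (Metric.mem_closedBall_self a.2)
    have h2 : ‖g y‖ ≤ ‖g 0‖ + dist (g y) (g 0) := by
      rw [dist_eq_norm]
      simpa using norm_add_le (g 0) (g y - g 0)
    have h3 : (K : ℝ) * dist y 0 ≤ K * a := by gcongr; exact hy
    simp only [L, NNReal.coe_add, NNReal.coe_mul, coe_nnnorm]
    linarith
  -- Chosen so that `L * ε ≤ a`, which keeps the solution in the ball; the `+ 1` guards against `L =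
  -- 0`.
  let ε : ℝ := a / (L + 1)
  have hε : 0 < ε := div_pos (by rw [ha]; positivity) (by positivity)
  have ht₀ : t₀ ∈ Icc (t₀ - ε) (t₀ + ε) := ⟨by linarith, by linarith⟩
  have hPL : IsPicardLindelof (fun _ => g) (⟨t₀, ht₀⟩ : Icc (t₀ - ε) (t₀ + ε)) 0 a 0 L K :=
    { lipschitzOnWith := fun _ _ => hlip
      continuousOn := fun _ _ => continuousOn_const
      norm_le := fun _ _ => hL
      mul_max_le := by
        simp only [add_sub_cancel_left, sub_sub_cancel, max_self, NNReal.coe_zero, sub_zero]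
        simp only [ε]
        rw [mul_div_assoc', div_le_iff₀ (by positivity)]
        nlinarith [a.2, L.2] }
  obtain ⟨y, hy0, hy⟩ := hPL.exists_eq_forall_mem_Icc_hasDerivWithinAt₀
  have hy' : ∀ t ∈ Ioo (t₀ - ε) (t₀ + ε), HasDerivAt y (g (y t)) t := fun t ht =>
    (hy t (Ioo_subset_Icc_self ht)).hasDerivAt (Icc_mem_nhds ht.1 ht.2)
  have hIoo : Ioo (t₀ - ε) (t₀ + ε) ∈ 𝓝 t₀ := Ioo_mem_nhds (by linarith) (by linarith)
  have hvel : ∀ t ∈ Ioo (t₀ - ε) (t₀ + ε), HasVelocity (fun s => x + LipVec.val F (y s)) t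
      (X (x + LipVec.val F (y t))) := fun t ht => (hy' t ht).hasVelocity_val x
  have hx0 : x + LipVec.val F (y t₀) = x := by
    rw [show y t₀ = 0 from hy0, map_zero, add_zero]
  refine ⟨fun t => x + LipVec.val F (y t), hx0, ?_⟩
  have hcont := (hvel t₀ (mem_of_mem_nhds hIoo)).continuousAt
  filter_upwards [hIoo, hcont.eventually_mem (h.isOpen.mem_nhds (by rwa [hx0]))] with t ht htU
  exact ⟨htU, hvel t ht⟩

end LocalExistence

/-! ### Tangent vectors, change of charts, and integral curves on the manifold. -/

section Manifold

variable {F : Type u} [AddCommGroup F] [Module ℝ F] [MetricSpace F] [StandardFrechetSpace F]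
variable {M : Type v} [TopologicalSpace M] [ChartedSpace F M]

/-- A linear map on `ℝ` is determined by its value `v` at `1`, so the finite Lipschitz norm demanded
of the derivative of an `MC^1`-curve is exactly finiteness of `radialNorm v`. -/
theorem MCCurvesAt.exists_hasVelocity {p : M} (f : MCCurvesAt F p) {φ : OpenPartialHomeomorph M F}
    (hφ : φ ∈ atlas F M) (hp : p ∈ φ.source) :
    ∃ v, HasVelocity (fun t => φ (f.1 t)) 0 v ∧ radialNorm v ≠ ∞ := by
  obtain ⟨⟨hc, hMC⟩, h0⟩ := f.2
  have hU : IsOpen (univ ∩ f.1 ⁻¹' φ.source) := hc.isOpen_inter_preimage isOpen_univ φ.open_source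
  obtain ⟨P', hP'⟩ := exists_hasMCDerivOn.{0, u} le_top hU (hMC φ hφ)
  have hmem : (0 : ℝ) ∈ univ ∩ f.1 ⁻¹' φ.source := ⟨mem_univ _, by rwa [mem_preimage, h0]⟩
  refine ⟨P' 0 1, hP'.hasDirDeriv 0 hmem 1, ?_⟩
  have h1 : LinearMap.toSpanSingleton ℝ F (P' 0 1) = P' 0 := by
    ext
    simp
  rw [radialNorm, h1]
  exact (hP'.lipNorm_lt 0 hmem).ne

theorem radialNorm_chartVelocity_ne_top (φ : OpenPartialHomeomorph M F) (p : M)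
    (V : TangentAt F p) : radialNorm (chartVelocity φ p V) ≠ ∞ := by
  unfold chartVelocity
  split_ifs with h
  · induction V using Quotient.ind with
    | _ f =>
      obtain ⟨v, hv, hfin⟩ := f.exists_hasVelocity h.1 h.2
      rw [Quotient.lift_mk, hv.velocity_eq]
      exact hfin
  -- The default value `0` makes the bound hold outside the chart as well, so principal parts have
  -- finite radial norm on all of `F`.
  · simp [radialNorm_zero]

theorem radialNorm_principalPart_ne_top (ξ : M → TangentBdl F M) (φ : OpenPartialHomeomorph M F)
    (y : F) : radialNorm (principalPart ξ φ y) ≠ ∞ :=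
  radialNorm_chartVelocity_ne_top _ _ _

omit [ChartedSpace F M] in
theorem hasVelocity_chart_change {φ ψ : OpenPartialHomeomorph M F} {P' : F → F →ₗ[ℝ] F}
    (h : HasMCDerivOn (φ.symm.trans ψ : F → F) P' (φ.symm.trans ψ).source) {ℓ : ℝ → M} {t : ℝ}
    (hℓ : ContinuousAt ℓ t) (hφ : ℓ t ∈ φ.source) (hψ : ℓ t ∈ ψ.source) {v : F}
    (hv : HasVelocity (fun s => φ (ℓ s)) t v) :
    HasVelocity (fun s => ψ (ℓ s)) t (P' (φ (ℓ t)) v) := by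
  have hmem : φ (ℓ t) ∈ (φ.symm.trans ψ).source := by
    simp [hφ, hψ]
  refine (h.hasVelocity_comp hv hmem).congr_of_eventuallyEq ?_
  filter_upwards [hℓ.eventually_mem (φ.open_source.mem_nhds hφ)] with s hs
  simp [hs]

theorem chartVelocity_chart_change {φ ψ : OpenPartialHomeomorph M F} (hφ : φ ∈ atlas F M)
    (hψ : ψ ∈ atlas F M) {P' : F → F →ₗ[ℝ] F}
    (h : HasMCDerivOn (φ.symm.trans ψ : F → F) P' (φ.symm.trans ψ).source) {p : M}
    (hpφ : p ∈ φ.source) (hpψ : p ∈ ψ.source) (V : TangentAt F p) :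
    chartVelocity ψ p V = P' (φ p) (chartVelocity φ p V) := by
  unfold chartVelocity
  rw [dif_pos ⟨hψ, hpψ⟩, dif_pos ⟨hφ, hpφ⟩]
  induction V using Quotient.ind with
  | _ f =>
    have hc : ContinuousAt f.1 0 := f.2.1.1.continuousAt univ_mem
    have h0 : f.1 0 = p := f.2.2
    obtain ⟨v, hv, -⟩ := f.exists_hasVelocity hφ hpφ
    have hw := hasVelocity_chart_change h hc (by rwa [h0]) (by rwa [h0]) hv
    rw [Quotient.lift_mk, Quotient.lift_mk, hv.velocity_eq, hw.velocity_eq, h0]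

omit [StandardFrechetSpace F] in
theorem principalPart_apply (ξ : M → TangentBdl F M) {φ : OpenPartialHomeomorph M F} {q : M}
    (hq : q ∈ φ.source) : principalPart ξ φ (φ q) = chartVelocity φ (ξ q).1 (ξ q).2 := by
  unfold principalPart tangentChart
  rw [φ.left_inv hq]

/-- Principal parts transform by the derivative of the transition map, as velocities of curves do.
Hence a curve that solves the equation in one chart solves it in every chart. -/
theorem principalPart_chart_change {ξ : M → TangentBdl F M} (hξ : ∀ p, (ξ p).proj = p)
    {φ ψ : OpenPartialHomeomorph M F} (hφ : φ ∈ atlas F M)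
    (hψ : ψ ∈ atlas F M) {P' : F → F →ₗ[ℝ] F}
    (h : HasMCDerivOn (φ.symm.trans ψ : F → F) P' (φ.symm.trans ψ).source) {q : M}
    (hqφ : q ∈ φ.source) (hqψ : q ∈ ψ.source) :
    principalPart ξ ψ (ψ q) = P' (φ q) (principalPart ξ φ (φ q)) := by
  have hq : (ξ q).1 = q := hξ q
  rw [principalPart_apply ξ hqφ, principalPart_apply ξ hqψ,
    chartVelocity_chart_change hφ hψ h (by rwa [hq]) (by rwa [hq])]
  exact congrArg (fun x => P' (φ x) (chartVelocity φ (ξ q).1 (ξ q).2)) hq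

omit [StandardFrechetSpace F] in
theorem IsIntegralCurveOfField.eventually_hasVelocity {ξ : M → TangentBdl F M} {I : Set ℝ}
    {ℓ : ℝ → M} (h : IsIntegralCurveOfField ξ I ℓ) {t : ℝ} (ht : t ∈ I)
    {φ : OpenPartialHomeomorph M F} (hφ : φ ∈ atlas F M) (hℓ : ℓ t ∈ φ.source) :
    ∀ᶠ s in 𝓝 t, φ (ℓ s) ∈ φ.target ∧
      HasVelocity (fun s => φ (ℓ s)) s (principalPart ξ φ (φ (ℓ s))) := by
  have hI : I ∈ 𝓝 t := h.isOpen.mem_nhds ht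
  filter_upwards [hI, (h.continuousOn.continuousAt hI).eventually_mem
    (φ.open_source.mem_nhds hℓ)] with s hs hsφ
  exact ⟨φ.map_source hsφ, h.hasVelocity s hs φ hφ hsφ⟩

theorem HasVelocity.hasDirDeriv_smul {c : ℝ → F} {t : ℝ} {v : F} (hv : HasVelocity c t v) (h : ℝ) :
    HasDirDeriv (metricNorm F) c t h (h • v) := by
  rw [hasDirDeriv_iff_tendsto]
  rw [hasVelocity_iff_tendsto] at hv
  by_cases hh : h = 0
  · simp [hh]
  have h1 : Tendsto (fun s : ℝ => s • h) (𝓝[≠] 0) (𝓝[≠] 0) := by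
    refine tendsto_nhdsWithin_iff.2 ⟨?_, ?_⟩
    · have h2 : Tendsto (fun s : ℝ => s • h) (𝓝 0) (𝓝 ((0 : ℝ) • h)) :=
        (continuous_id.smul continuous_const).tendsto 0
      rw [zero_smul] at h2
      exact h2.mono_left nhdsWithin_le_nhds
    · filter_upwards [self_mem_nhdsWithin] with s hs
      exact smul_ne_zero hs hh
  refine ((hv.comp h1).const_smul h).congr' ?_
  filter_upwards [self_mem_nhdsWithin] with s hs
  simp only [Function.comp, smul_smul, smul_eq_mul]
  rw [mul_inv_rev, mul_inv_cancel_left₀ hh]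

/-- Integral curves of `MC^1`-fields are of class `MC^1`. -/
theorem IsIntegralCurveOfField.isMCCurveOn_one {k : ℕ∞} (hk : 1 ≤ k) {ξ : M → TangentBdl F M}
    (hξ : IsVectorField k ξ) {I : Set ℝ} {ℓ : ℝ → M} (h : IsIntegralCurveOfField ξ I ℓ) :
    IsMCCurveOn F 1 I ℓ := by
  refine ⟨h.continuousOn, fun φ hφ n hn => ?_⟩
  have hopen : IsOpen (I ∩ ℓ ⁻¹' φ.source) :=
    h.continuousOn.isOpen_inter_preimage h.isOpen φ.open_source
  have hcont : QContinuousOn (metricNorm F) (I ∩ ℓ ⁻¹' φ.source) (fun t => φ (ℓ t)) :=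
    qContinuousOn_iff.2 fun t ht =>
      (h.hasVelocity t ht.1 φ hφ ht.2).continuousAt.continuousWithinAt
  have hn1 : n ≤ 1 := by exact_mod_cast hn
  interval_cases n
  · exact hcont
  obtain ⟨X', hX'⟩ := exists_hasMCDerivOn.{u, u} hk φ.open_target (hξ.principalPart_MC φ hφ)
  have hfin := radialNorm_principalPart_ne_top ξ φ
  refine ⟨hcont, fun t => LinearMap.toSpanSingleton ℝ F (principalPart ξ φ (φ (ℓ t))),
    fun t ht => ⟨(hfin _).lt_top, fun s => ?_⟩, fun t ht => ?_⟩
  · rw [LinearMap.toSpanSingleton_apply]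
    exact (h.hasVelocity t ht.1 φ hφ ht.2).hasDirDeriv_smul s
  -- A ball is used because the neighbourhood in the definition of `MC^1` must be connected.
  · obtain ⟨ε, hε, hball⟩ := Metric.isOpen_iff.1 hopen t ht
    refine ⟨Metric.ball t ε, Metric.isOpen_ball,
      (convex_ball t ε).isConnected ⟨t, Metric.mem_ball_self hε⟩, Metric.mem_ball_self hε, hball,
      fun s hs => ?_⟩
    have hlim := hX'.tendsto_radialNorm_velocity hfin
      (h.eventually_hasVelocity (hball hs).1 hφ (hball hs).2)
    refine (hlim.mono_left nhdsWithin_le_nhds).congr fun r => ?_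
    rw [radialNorm]
    congr 1
    ext
    simp

variable [BoundedFrechetManifold F M]

theorem exists_hasMCDerivOn_transition {φ ψ : OpenPartialHomeomorph M F} (hφ : φ ∈ atlas F M)
    (hψ : ψ ∈ atlas F M) :
    ∃ P', HasMCDerivOn (φ.symm.trans ψ : F → F) P' (φ.symm.trans ψ).source :=
  exists_hasMCDerivOn.{u, u} le_top (φ.symm.trans ψ).open_source
    (BoundedFrechetManifold.transition_MC φ hφ ψ hψ)

theorem exists_isIntegralCurveOfField {k : ℕ∞} (hk : 1 ≤ k) {ξ : M → TangentBdl F M}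
    (hξ : IsVectorField k ξ) (p : M) (t₀ : ℝ) :
    ∃ (I : Set ℝ) (ℓ : ℝ → M), t₀ ∈ I ∧ ℓ t₀ = p ∧ IsIntegralCurveOfField ξ I ℓ := by
  set φ := chartAt F p
  have hφ : φ ∈ atlas F M := chart_mem_atlas F p
  have hp : p ∈ φ.source := mem_chart_source F p
  obtain ⟨X', hX'⟩ := exists_hasMCDerivOn.{u, u} hk φ.open_target (hξ.principalPart_MC φ hφ)
  obtain ⟨c, hc0, hc⟩ := hX'.exists_velocity (radialNorm_principalPart_ne_top ξ φ)
    (φ.map_source hp) t₀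
  obtain ⟨ε, hε, hball⟩ := Metric.eventually_nhds_iff_ball.1 hc
  have hcont : ∀ t ∈ Metric.ball t₀ ε, ContinuousAt (fun t => φ.symm (c t)) t := fun t ht =>
    (φ.continuousAt_symm (hball t ht).1).comp (hball t ht).2.continuousAt
  refine ⟨Metric.ball t₀ ε, fun t => φ.symm (c t), Metric.mem_ball_self hε,
    by simp only [hc0, φ.left_inv hp], Metric.isOpen_ball, (convex_ball t₀ ε).ordConnected,
    fun t ht => (hcont t ht).continuousWithinAt, fun t ht ψ hψ htψ => ?_⟩
  obtain ⟨P', hP'⟩ := exists_hasMCDerivOn_transition hφ hψ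
  have htφ : φ.symm (c t) ∈ φ.source := φ.map_target (hball t ht).1
  rw [principalPart_chart_change hξ.section_proj hφ hψ hP' htφ htψ]
  refine hasVelocity_chart_change hP' (hcont t ht) htφ htψ ?_
  rw [φ.right_inv (hball t ht).1]
  refine (hball t ht).2.congr_of_eventuallyEq ?_
  filter_upwards [Metric.isOpen_ball.mem_nhds ht] with s hs
  exact φ.right_inv (hball s hs).1

omit [BoundedFrechetManifold F M] in
theorem IsIntegralCurveOfField.eventuallyEq {k : ℕ∞} (hk : 1 ≤ k) {ξ : M → TangentBdl F M}
    (hξ : IsVectorField k ξ) {I₁ I₂ : Set ℝ} {ℓ₁ ℓ₂ : ℝ → M}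
    (h₁ : IsIntegralCurveOfField ξ I₁ ℓ₁) (h₂ : IsIntegralCurveOfField ξ I₂ ℓ₂) {t : ℝ}
    (ht₁ : t ∈ I₁) (ht₂ : t ∈ I₂) (h : ℓ₁ t = ℓ₂ t) : ℓ₁ =ᶠ[𝓝 t] ℓ₂ := by
  set φ := chartAt F (ℓ₁ t)
  have hφ : φ ∈ atlas F M := chart_mem_atlas F _
  have hp₁ : ℓ₁ t ∈ φ.source := mem_chart_source F _
  have hp₂ : ℓ₂ t ∈ φ.source := h ▸ hp₁
  obtain ⟨X', hX'⟩ := exists_hasMCDerivOn.{u, u} hk φ.open_target (hξ.principalPart_MC φ hφ)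
  have heq := hX'.eventuallyEq_of_velocity (radialNorm_principalPart_ne_top ξ φ)
    (h₁.eventually_hasVelocity ht₁ hφ hp₁) (h₂.eventually_hasVelocity ht₂ hφ hp₂) (by rw [h])
  filter_upwards [heq, (h₁.continuousOn.continuousAt (h₁.isOpen.mem_nhds ht₁)).eventually_mem
    (φ.open_source.mem_nhds hp₁), (h₂.continuousOn.continuousAt
    (h₂.isOpen.mem_nhds ht₂)).eventually_mem (φ.open_source.mem_nhds hp₂)] with s hs hs₁ hs₂
  exact φ.injOn hs₁ hs₂ hs

/-- The set of times near which the curves agree is open; in `I₁ ∩ I₂` it is also closed, since at a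
limit time the values agree by the Hausdorff property and local uniqueness applies again. -/
theorem IsIntegralCurveOfField.eqOn {k : ℕ∞} (hk : 1 ≤ k) {ξ : M → TangentBdl F M}
    (hξ : IsVectorField k ξ) {I₁ I₂ : Set ℝ} {ℓ₁ ℓ₂ : ℝ → M}
    (h₁ : IsIntegralCurveOfField ξ I₁ ℓ₁) (h₂ : IsIntegralCurveOfField ξ I₂ ℓ₂) {t₀ : ℝ}
    (ht₁ : t₀ ∈ I₁) (ht₂ : t₀ ∈ I₂) (h : ℓ₁ t₀ = ℓ₂ t₀) : EqOn ℓ₁ ℓ₂ (I₁ ∩ I₂) := by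
  have : T2Space M := BoundedFrechetManifold.t2 F
  have hJ : IsPreconnected (I₁ ∩ I₂) := (h₁.ordConnected.inter h₂.ordConnected).isPreconnected
  have hsub := hJ.subset_of_closure_inter_subset (u := {t | ∀ᶠ s in 𝓝 t, ℓ₁ s = ℓ₂ s})
    isOpen_setOfPred_eventually_nhds ⟨t₀, ⟨ht₁, ht₂⟩, h₁.eventuallyEq hk hξ h₂ ht₁ ht₂ h⟩ (by
      rintro t ⟨htc, ht⟩
      refine h₁.eventuallyEq hk hξ h₂ ht.1 ht.2 ?_
      have hc₁ := h₁.continuousOn.continuousAt (h₁.isOpen.mem_nhds ht.1)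
      have hc₂ := h₂.continuousOn.continuousAt (h₂.isOpen.mem_nhds ht.2)
      refine tendsto_nhds_unique_of_frequently_eq hc₁ hc₂ ?_
      exact (mem_closure_iff_frequently.1 htc).mono fun s hs => hs.self_of_nhds)
  exact fun t ht => (hsub ht).self_of_nhds

end Manifold

end BoundedFrechet

theorem mainTheorem5
    {F : Type u} [AddCommGroup F] [Module ℝ F] [MetricSpace F] [StandardFrechetSpace F]
    {M : Type v} [TopologicalSpace M] [ChartedSpace F M] [BoundedFrechetManifold F M]
    (k : ℕ∞) (hk : 1 ≤ k)
    (ξ : M → TangentBdl F M) (hξ : IsVectorField k ξ) (p : M) (t₀ : ℝ) :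
    (∃ (I : Set ℝ) (ℓ : ℝ → M), t₀ ∈ I ∧ ℓ t₀ = p ∧
      IsIntegralCurveOfField ξ I ℓ ∧ IsMCCurveOn F 1 I ℓ) ∧
    (∀ (I₁ I₂ : Set ℝ) (ℓ₁ ℓ₂ : ℝ → M),
      t₀ ∈ I₁ → t₀ ∈ I₂ → ℓ₁ t₀ = p → ℓ₂ t₀ = p →
      IsIntegralCurveOfField ξ I₁ ℓ₁ → IsIntegralCurveOfField ξ I₂ ℓ₂ →
      ∀ t ∈ I₁ ∩ I₂, ℓ₁ t = ℓ₂ t) := by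
  refine ⟨?_, fun I₁ I₂ ℓ₁ ℓ₂ ht₁ ht₂ h₁ h₂ hℓ₁ hℓ₂ =>
    hℓ₁.eqOn hk hξ hℓ₂ ht₁ ht₂ (h₁.trans h₂.symm)⟩
  obtain ⟨I, ℓ, ht₀, h0, hℓ⟩ := exists_isIntegralCurveOfField hk hξ p t₀
  exact ⟨I, ℓ, ht₀, h0, hℓ, hℓ.isMCCurveOn_one hk hξ⟩
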